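/- Let $K>1$, $n\ge 1$, $m\ge 0$ be integers, $y^*\in\mathbb R^m$, $\sigma_w>0$, let $\Pi\subset\mathbb R^n$ be convex and compact, and let $\Theta\subset\mathbb R^{K\times m\times(n+1)}$ be a compact set of parameters $\theta=(A_k,b_k)_{k=1}^K$, $A_k\in\mathbb R^{m\times n}$, $b_k\in\mathbb R^m$. **Model.** Let $(s_t)_{t\ge 0}$ be a Markov chain on $\{1,\dots,K\}$ with transition matrix $P=(p_{i,j})$. In period $t\ge1$ the input $x_t\in\mathbb R^n$ produces the output $y_t=A_{s_t}x_t+b_{s_t}+w_t$, where, given the states, the noises $w_t$ are independent and $w_t$ has law $f_{s_t}$. For the quadratic stage cost $\mathbb E(\|y^*-y_t\|_2^2\mid s_{t-1}=i,\,x_t)$ the optimal input is $$x_i^*(\theta,P)=\Bigl(\sum_j p_{i,j}A_j^{\top}A_j\Bigr)^{-1}\sum_j p_{i,j}A_j^{\top}(y^*-b_j).$$ A triple $(\theta,P,(f_k)_{k=1}^K)$ is *admissible* if $\theta\in\Theta$, every $A_k$ has full column rank, $P$ is a stochastic matrix, every $f_k$ is a probability law with mean zero whose entries satisfy $\mathbb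 E(w_{t,i}^2)\le\sigma_w^2$ and $\mathbb E(w_{t,i}^4)\le\sigma_w^4$, and $x_i^*(\theta,P)\in\Pi$ for every state $i$. **Policies.** A policy $\mu$ chooses $x_t^\mu$ as a measurable function of $I_{t-1}=(x_1,\dots,x_{t-1},y_1,\dots,y_{t-1},s_0,\dots,s_{t-1})$ and of a random seed that is independent of the states and the noises; a sequence of estimates $(\hat x_t^\mu)$ of the optimal input is obtained in the same way, as measurable functions of $I_{t-1}$ and the seed. Put $$\hat{\mathcal E}_T^\mu=\sup\,\mathbb E\sum_{t=1}^T\|\hat x_t^\mu-x_{s_{t-1}}^*(\theta,P)\|_2^2,\qquad \bar{\mathcal E}_T^\mu=\sup\,\mathbb E\sum_{t=1}^T\|x_t^\mu-x_{s_{t-1}}^*(\theta,P)\|_2^2,$$ both suprema (in $[0,\infty]$) being over all admissible $(\theta,P,(f_k)_k)$. **Theorem.** Assume that $\Theta$ has an interior point $\theta^\circ$ whose matrices all have full column rank and for which the optimal input under the uniform transition matrix ($p_{i,j}=1/K$) lies in the interior of $\Pi$. Then there is a constant $C>0$, depending only on $K,m,n,y^*,\sigma_w,\Theta,\Pi$,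 such that for every initial distribution of $s_0$, every policy $\mu$, every sequence of estimates $(\hat x_t^\mu)$ and every $T\in\mathbb N$, $$\hat{\mathcal E}_T^\mu\;\bar{\mathcal E}_T^\mu\;\ge\;C\,T .$$ -/

import Mathlib

open MeasureTheory Matrix WithLp
open scoped ENNReal

noncomputable section

namespace JumpAffine

/-- System parameters `θ = (A_k, b_k)`, `k = 1, …, K`, with `A_k ∈ ℝ^{m × n}` and `b_k ∈ ℝ^m`. -/
abbrev Param (K m n : ℕ) : Type :=
  Fin K → Matrix (Fin m) (Fin n) ℝ × EuclideanSpace ℝ (Fin m)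

/-- The affine response `A x + b` of one state. -/
def response {m n : ℕ} (q : Matrix (Fin m) (Fin n) ℝ × EuclideanSpace ℝ (Fin m))
    (x : EuclideanSpace ℝ (Fin n)) : EuclideanSpace ℝ (Fin m) :=
  toLp 2 (q.1 *ᵥ ofLp x) + q.2

/-- The quadratic stage cost `E (‖y* - y_t‖² | s_{t-1} = i, x_t = x)`, where the next state `j`
has probability `p_{i,j}` and the noise in state `j` has law `f j`. -/
def stageCost {K m n : ℕ} (ystar : EuclideanSpace ℝ (Fin m)) (θ : Param K m n)
    (P : Matrix (Fin K) (Fin K) ℝ) (f : Fin K → Measure (EuclideanSpace ℝ (Fin m)))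
    (i : Fin K) (x : EuclideanSpace ℝ (Fin n)) : ℝ :=
  ∑ j, P i j * ∫ w, ‖ystar - (response (θ j) x + w)‖ ^ 2 ∂(f j)

/-- The optimal input
`x*_i = (∑_j p_{i,j} A_jᵀ A_j)⁻¹ (∑_j p_{i,j} A_jᵀ (y* - b_j))` after state `i`. It is the unique
minimizer of the stage cost, see `stageCost_optimalInput_lt`. -/
def optimalInput {K m n : ℕ} (ystar : EuclideanSpace ℝ (Fin m)) (θ : Param K m n)
    (P : Matrix (Fin K) (Fin K) ℝ) (i : Fin K) : EuclideanSpace ℝ (Fin n) :=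
  toLp 2 ((∑ j, P i j • ((θ j).1ᵀ * (θ j).1))⁻¹ *ᵥ
    (∑ j, P i j • ((θ j).1ᵀ *ᵥ ofLp (ystar - (θ j).2))))

/-- Noise laws: centred, with entries satisfying `E w_i² ≤ σ²` and `E w_i⁴ ≤ σ⁴`. -/
structure IsNoiseLaw {m : ℕ} (σ : ℝ) (f : Measure (EuclideanSpace ℝ (Fin m))) : Prop where
  isProbabilityMeasure : IsProbabilityMeasure f
  mean_zero : ∫ w, w ∂f = 0
  second_moment : ∀ i, ∫⁻ w, ‖w i‖ₑ ^ 2 ∂f ≤ ENNReal.ofReal (σ ^ 2)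
  fourth_moment : ∀ i, ∫⁻ w, ‖w i‖ₑ ^ 4 ∂f ≤ ENNReal.ofReal (σ ^ 4)

/-- If the `A_k` have full column rank, `optimalInput` is the unique minimizer of the stage cost. -/
theorem stageCost_optimalInput_lt {K m n : ℕ} {ystar : EuclideanSpace ℝ (Fin m)} {σ : ℝ}
    {θ : Param K m n} {P : Matrix (Fin K) (Fin K) ℝ}
    {f : Fin K → Measure (EuclideanSpace ℝ (Fin m))}
    (hθ : ∀ k, (θ k).1.rank = n) (hP : P ∈ rowStochastic ℝ (Fin K))
    (hf : ∀ k, IsNoiseLaw σ (f k)) (i : Fin K) {x : EuclideanSpace ℝ (Fin n)}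
    (hx : x ≠ optimalInput ystar θ P i) :
    stageCost ystar θ P f i (optimalInput ystar θ P i) < stageCost ystar θ P f i x := by
  obtain ⟨hP0, hP1⟩ := mem_rowStochastic_iff_sum.1 hP
  have hinj : ∀ k (v : Fin n → ℝ), (θ k).1 *ᵥ v = 0 → v = 0 := by
    intro k v hv
    have h1 := LinearMap.finrank_range_add_finrank_ker (θ k).1.mulVecLin
    have h2 : Module.finrank ℝ (LinearMap.range (θ k).1.mulVecLin) = n := hθ k
    rw [h2, Module.finrank_fin_fun] at h1
    have h3 : LinearMap.ker (θ k).1.mulVecLin = ⊥ :=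
      Submodule.finrank_eq_zero.1 (by omega)
    exact LinearMap.ker_eq_bot'.1 h3 v hv
  have hpos : ∃ j, 0 < P i j := by
    by_contra! h
    have := Finset.sum_nonpos (s := Finset.univ) (f := fun j => P i j) (fun j _ => h j)
    rw [hP1 i] at this
    linarith
  -- the quadratic form of `∑ p A^T A` is definite
  have hdef : ∀ v : Fin n → ℝ, v ≠ 0 →
      0 < ∑ j, P i j * (((θ j).1 *ᵥ v) ⬝ᵥ ((θ j).1 *ᵥ v)) := by
    intro v hv
    obtain ⟨j, hj⟩ := hpos
    refine Finset.sum_pos' (fun k _ => mul_nonneg (hP0 i k) (by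
      simpa using dotProduct_star_self_nonneg ((θ k).1 *ᵥ v))) ⟨j, Finset.mem_univ _, ?_⟩
    refine mul_pos hj (lt_of_le_of_ne (by
      simpa using dotProduct_star_self_nonneg ((θ j).1 *ᵥ v)) ?_)
    intro h
    exact hv (hinj j v (dotProduct_self_eq_zero.1 h.symm))
  set G : Matrix (Fin n) (Fin n) ℝ := ∑ j, P i j • ((θ j).1ᵀ * (θ j).1) with hG
  have hGv : ∀ v, G *ᵥ v = ∑ j, P i j • ((θ j).1ᵀ *ᵥ ((θ j).1 *ᵥ v)) := by
    intro v
    simp [hG, sum_mulVec, smul_mulVec, mulVec_mulVec]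
  have hdet : IsUnit G.det := by
    rw [isUnit_iff_ne_zero]
    intro h
    obtain ⟨v, hv, hv0⟩ := exists_mulVec_eq_zero_iff.2 h
    have h1 := hdef v hv
    have h2 : v ⬝ᵥ (G *ᵥ v) = ∑ j, P i j * (((θ j).1 *ᵥ v) ⬝ᵥ ((θ j).1 *ᵥ v)) := by
      rw [hGv, dotProduct_sum]
      refine Finset.sum_congr rfl fun j _ => ?_
      rw [dotProduct_smul, smul_eq_mul, dotProduct_mulVec, vecMul_transpose]
    rw [hv0, dotProduct_zero] at h2
    linarith
  set xs := optimalInput ystar θ P i with hxs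
  have hnormal : ∑ j, P i j • ((θ j).1ᵀ *ᵥ ofLp (ystar - response (θ j) xs)) = 0 := by
    have h1 : G *ᵥ ofLp xs = ∑ j, P i j • ((θ j).1ᵀ *ᵥ ofLp (ystar - (θ j).2)) := by
      rw [hxs, optimalInput, mulVec_mulVec, ← hG, mul_nonsing_inv _ hdet, one_mulVec]
    rw [hGv] at h1
    rw [← sub_eq_zero.2 h1.symm, ← Finset.sum_sub_distrib]
    refine Finset.sum_congr rfl fun j _ => ?_
    rw [← smul_sub, ← mulVec_sub]
    congr 2
    simp only [response, ofLp_sub, ofLp_add]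
    abel
  have hint : ∀ j (a : EuclideanSpace ℝ (Fin m)),
      ∫ w, ‖a - w‖ ^ 2 ∂(f j) = ‖a‖ ^ 2 + ∫ w, ‖w‖ ^ 2 ∂(f j) := by
    intro j a
    have := (hf j).isProbabilityMeasure
    have hL2 : MemLp (fun w : EuclideanSpace ℝ (Fin m) => w) 2 (f j) := by
      refine ⟨by fun_prop, ?_⟩
      rw [eLpNorm_lt_top_iff_lintegral_rpow_enorm_lt_top (by norm_num) (by norm_num)]
      have h1 : ∀ w : EuclideanSpace ℝ (Fin m),
          ‖w‖ₑ ^ (2 : ℝ≥0∞).toReal = ∑ l, ‖w l‖ₑ ^ 2 := by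
        intro w
        have h2 : ‖w‖ₑ ^ 2 = ∑ l, ‖w l‖ₑ ^ 2 := by
          simp only [← ofReal_norm, ← ENNReal.ofReal_pow (norm_nonneg _)]
          rw [EuclideanSpace.norm_sq_eq, ENNReal.ofReal_sum_of_nonneg (fun _ _ => by positivity)]
        rw [← h2]
        simp
      simp only [h1]
      rw [lintegral_finsetSum _ (fun l _ => by fun_prop)]
      exact ENNReal.sum_lt_top.2 fun l _ =>
        ((hf j).second_moment l).trans_lt ENNReal.ofReal_lt_top
    have hI : Integrable (fun w : EuclideanSpace ℝ (Fin m) => w) (f j) :=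
      hL2.integrable (by norm_num)
    have hI2 : Integrable (fun w : EuclideanSpace ℝ (Fin m) => ‖w‖ ^ 2) (f j) :=
      hL2.integrable_norm_pow (by norm_num)
    have hI3 : Integrable (fun w : EuclideanSpace ℝ (Fin m) => 2 * inner ℝ a w) (f j) :=
      (hI.const_inner a).const_mul 2
    simp only [norm_sub_sq_real]
    have e1 : ∫ w, (‖a‖ ^ 2 - 2 * inner ℝ a w + ‖w‖ ^ 2) ∂(f j) =
        ∫ w, (‖a‖ ^ 2 - 2 * inner ℝ a w) ∂(f j) + ∫ w, ‖w‖ ^ 2 ∂(f j) :=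
      integral_add ((integrable_const _).sub hI3) hI2
    have e2 : ∫ w, (‖a‖ ^ 2 - 2 * inner ℝ a w) ∂(f j) =
        ∫ _, ‖a‖ ^ 2 ∂(f j) - ∫ w, 2 * inner ℝ a w ∂(f j) :=
      integral_sub (integrable_const _) hI3
    rw [e1, e2, integral_const_mul, integral_inner hI, (hf j).mean_zero]
    simp
  have hcost : ∀ z, stageCost ystar θ P f i z =
      ∑ j, P i j * (‖ystar - response (θ j) z‖ ^ 2 + ∫ w, ‖w‖ ^ 2 ∂(f j)) := by
    intro z
    refine Finset.sum_congr rfl fun j _ => ?_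
    rw [← hint]
    simp only [sub_sub]
  have hd : ofLp (x - xs) ≠ 0 := by
    intro h
    exact hx (sub_eq_zero.1 ((ofLp_eq_zero 2).1 h))
  have key : stageCost ystar θ P f i x = stageCost ystar θ P f i xs +
      ∑ j, P i j * (((θ j).1 *ᵥ ofLp (x - xs)) ⬝ᵥ ((θ j).1 *ᵥ ofLp (x - xs))) := by
    have hcross : ∑ j, P i j *
        (((θ j).1 *ᵥ ofLp (x - xs)) ⬝ᵥ ofLp (ystar - response (θ j) xs)) = 0 := by
      have h1 := congrArg (fun v => ofLp (x - xs) ⬝ᵥ v) hnormal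
      simp only [dotProduct_sum, dotProduct_zero, dotProduct_smul, smul_eq_mul] at h1
      rw [← h1]
      refine Finset.sum_congr rfl fun j _ => ?_
      rw [dotProduct_mulVec, vecMul_transpose]
    have hterm : ∀ j, ‖ystar - response (θ j) x‖ ^ 2 = ‖ystar - response (θ j) xs‖ ^ 2
        + ((θ j).1 *ᵥ ofLp (x - xs)) ⬝ᵥ ((θ j).1 *ᵥ ofLp (x - xs))
        - 2 * (((θ j).1 *ᵥ ofLp (x - xs)) ⬝ᵥ ofLp (ystar - response (θ j) xs)) := by
      intro j
      have h1 : ystar - response (θ j) x = (ystar - response (θ j) xs) -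
          toLp 2 ((θ j).1 *ᵥ ofLp (x - xs)) := by
        simp only [response, ofLp_sub, mulVec_sub, toLp_sub]
        abel
      have h2 : ∀ v : EuclideanSpace ℝ (Fin m), ‖v‖ ^ 2 = ofLp v ⬝ᵥ ofLp v := by
        intro v
        rw [EuclideanSpace.norm_sq_eq]
        simp [dotProduct, sq]
      rw [h1, h2, h2, ofLp_sub]
      generalize (θ j).1 *ᵥ ofLp (x - xs) = p
      generalize ofLp (ystar - response (θ j) xs) = q
      simp only [sub_dotProduct, dotProduct_sub]
      rw [dotProduct_comm q p]
      ring
    have h3 := congrArg (fun r => 2 * r) hcross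
    simp only [mul_zero, Finset.mul_sum] at h3
    rw [hcost, hcost, ← Finset.sum_add_distrib, ← sub_eq_zero, ← neg_zero, ← h3,
      ← Finset.sum_sub_distrib, ← Finset.sum_neg_distrib]
    refine Finset.sum_congr rfl fun j _ => ?_
    rw [hterm]
    ring
  rw [key]
  linarith [hdef _ hd]

/-- The class of models `(θ, P, f)` over which the worst case is taken. -/
structure IsAdmissible {K m n : ℕ} (ystar : EuclideanSpace ℝ (Fin m)) (σ : ℝ)
    (Θ : Set (Param K m n)) (Pi0 : Set (EuclideanSpace ℝ (Fin n)))
    (θ : Param K m n) (P : Matrix (Fin K) (Fin K) ℝ)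
    (f : Fin K → Measure (EuclideanSpace ℝ (Fin m))) : Prop where
  mem : θ ∈ Θ
  full_rank : ∀ k, (θ k).1.rank = n
  stochastic : P ∈ rowStochastic ℝ (Fin K)
  noise : ∀ k, IsNoiseLaw σ (f k)
  optimalInput_mem : ∀ i, optimalInput ystar θ P i ∈ Pi0

/-- The information available after `t` periods:
`(x_1, …, x_t)`, `(y_1, …, y_t)` and `(s_0, …, s_t)`. -/
abbrev History (K m n t : ℕ) : Type :=
  (Fin t → EuclideanSpace ℝ (Fin n)) × (Fin t → EuclideanSpace ℝ (Fin m)) ×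
    (Fin (t + 1) → Fin K)

/-- A sequence of (possibly randomized) non-anticipating rules: `toFun t` maps an internal random
seed and the information after `t` periods to a vector of `ℝ^n` for period `t + 1`.
Both policies and sequences of estimates of the optimal input are of this kind. -/
structure CausalRule (K m n : ℕ) (U : Type*) [MeasurableSpace U] where
  toFun : (t : ℕ) → U × History K m n t → EuclideanSpace ℝ (Fin n)
  measurable_toFun : ∀ t, Measurable (toFun t)

section Trajectory

variable {K m n T : ℕ} {U : Type*} [MeasurableSpace U]

/-- The information after `t` periods when the policy `μ` runs on the system `θ` with seed `u`,
states `s_0, …, s_T` and noises `w_1, …, w_T` (the noise of period `t + 1` is `w t`):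
in period `t + 1` the input is `x = μ_t(u, I_t)` and the output is
`A_{s_{t+1}} x + b_{s_{t+1}} + w_{t+1}`. -/
def history (θ : Param K m n) (μ : CausalRule K m n U) (u : U) (s : Fin (T + 1) → Fin K)
    (w : Fin T → EuclideanSpace ℝ (Fin m)) : (t : ℕ) → t ≤ T → History K m n t
  | 0, _ => (Fin.elim0, Fin.elim0, fun _ => s 0)
  | t + 1, h =>
    let I := history θ μ u s w t (Nat.le_of_succ_le h)
    let x := μ.toFun t (u, I)
    let j := s ⟨t + 1, Nat.lt_succ_of_le h⟩
    (Fin.snoc I.1 x, Fin.snoc I.2.1 (response (θ j) x + w ⟨t, h⟩), Fin.snoc I.2.2 j)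

/-- Probability of the state path `s_0, …, s_T` of the Markov chain with initial distribution `π`
and transition matrix `P`. -/
def pathProb (π : Fin K → ℝ) (P : Matrix (Fin K) (Fin K) ℝ) (s : Fin (T + 1) → Fin K) : ℝ :=
  π (s 0) * ∏ t : Fin T, P (s t.castSucc) (s t.succ)

/-- Joint law of the seed, the states `s_0, …, s_T` and the noises `w_1, …, w_T`: the seed has law
`ρ` and is independent of the rest, the states form a Markov chain, and, given the states, the
noises are independent, `w_t` having law `f_{s_t}`. -/
def systemLaw (T : ℕ) (ρ : Measure U) (π : Fin K → ℝ) (P : Matrix (Fin K) (Fin K) ℝ)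
    (f : Fin K → Measure (EuclideanSpace ℝ (Fin m))) :
    Measure (U × (Fin (T + 1) → Fin K) × (Fin T → EuclideanSpace ℝ (Fin m))) :=
  ∑ s : Fin (T + 1) → Fin K, ENNReal.ofReal (pathProb π P s) •
    ρ.prod ((Measure.dirac s).prod (Measure.pi fun t : Fin T => f (s t.succ)))

/-- The cumulative mean squared error `E ∑_{t=1}^T ‖x̂_t - x*_{s_{t-1}}‖²` of the estimates `est`
computed from the data that the policy `μ` generates. -/
def cumulativeMSE (T : ℕ) (ystar : EuclideanSpace ℝ (Fin m)) (ρ : Measure U) (π : Fin K → ℝ)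
    (μ est : CausalRule K m n U) (θ : Param K m n) (P : Matrix (Fin K) (Fin K) ℝ)
    (f : Fin K → Measure (EuclideanSpace ℝ (Fin m))) : ℝ≥0∞ :=
  ∫⁻ ω, ∑ t : Fin T,
    ‖est.toFun t (ω.1, history θ μ ω.1 ω.2.1 ω.2.2 t t.isLt.le) -
      optimalInput ystar θ P (ω.2.1 t.castSucc)‖ₑ ^ 2 ∂(systemLaw T ρ π P f)

/-- Worst-case cumulative estimation-MSE of the estimates `est` under the policy `μ`. -/
def worstEstimationMSE (T : ℕ) (ystar : EuclideanSpace ℝ (Fin m)) (σ : ℝ)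
    (Θ : Set (Param K m n)) (Pi0 : Set (EuclideanSpace ℝ (Fin n))) (ρ : Measure U)
    (π : Fin K → ℝ) (μ est : CausalRule K m n U) : ℝ≥0∞ :=
  ⨆ (θ : Param K m n) (P : Matrix (Fin K) (Fin K) ℝ)
    (f : Fin K → Measure (EuclideanSpace ℝ (Fin m)))
    (_ : IsAdmissible ystar σ Θ Pi0 θ P f), cumulativeMSE T ystar ρ π μ est θ P f

/-- Worst-case cumulative input-MSE `sup E ∑_{t=1}^T ‖x_t - x*_{s_{t-1}}‖²` of the policy `μ`. -/
def worstInputMSE (T : ℕ) (ystar : EuclideanSpace ℝ (Fin m)) (σ : ℝ)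
    (Θ : Set (Param K m n)) (Pi0 : Set (EuclideanSpace ℝ (Fin n))) (ρ : Measure U)
    (π : Fin K → ℝ) (μ : CausalRule K m n U) : ℝ≥0∞ :=
  ⨆ (θ : Param K m n) (P : Matrix (Fin K) (Fin K) ℝ)
    (f : Fin K → Measure (EuclideanSpace ℝ (Fin m)))
    (_ : IsAdmissible ystar σ Θ Pi0 θ P f), cumulativeMSE T ystar ρ π μ μ θ P f

end Trajectory

end JumpAffine

end

open ProbabilityTheory Filter Topology
open scoped NNReal

/-!
A policy that plays nearly optimal inputs learns little. Start from an interior model under the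
uniform transition matrix, where one input `x` is optimal after every state; as this matrix is
singular, the offsets can be moved slightly so that some state `k` has a nonzero residual
`A_k x + b_k - y*`, while `x` stays optimal. Replacing `A_k` by `A_k + δ r e_lᵀ`, with `r` along the
residual, and compensating in `b_k` so that the response to `x` is unchanged, moves the optimal
input by an amount of order `δ`. For Gaussian noise along `r`, the data of the two systems differ
by a predictable shift of the noise, of total energy at most `δ²` times the input error `I` of the
policy. By Le Cam's two-point argument, as long as `δ² I` is small the estimation error is of
order at least `T δ²`; now let `δ²` be of order `1 / I`.
-/

namespace JumpAffine

section GaussianShift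

variable {T : ℕ}

/-- The law of `T` independent standard Gaussian variables, the driving noise of the hard
instances. -/
noncomputable abbrev gaussianSeq (T : ℕ) : Measure (Fin T → ℝ) :=
  Measure.pi fun _ : Fin T => gaussianReal 0 1

/-- Predictable processes: the value at time `t` depends only on the coordinates before `t`. -/
def IsPredictable (c : Fin T → (Fin T → ℝ) → ℝ) : Prop :=
  ∀ t w w', (∀ i < t, w i = w' i) → c t w = c t w'

/-- The density, with respect to the law of a standard Gaussian sequence, of the law under which
`w - c w` is a standard Gaussian sequence, for a predictable shift `c`. -/
noncomputable def shiftDensity (c : Fin T → (Fin T → ℝ) → ℝ) (w : Fin T → ℝ) : ℝ≥0∞ :=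
  ENNReal.ofReal (Real.exp (∑ t, (c t w * w t - c t w ^ 2 / 2)))

theorem IsPredictable.comp_cons {c : Fin (T + 1) → (Fin (T + 1) → ℝ) → ℝ}
    (hc : IsPredictable c) (a : ℝ) :
    IsPredictable fun (t : Fin T) (w : Fin T → ℝ) => c t.succ (Fin.cons a w) := by
  intro t w w' h
  refine hc _ _ _ fun i hi => ?_
  induction i using Fin.cases with
  | zero => rfl
  | succ j => simpa using h j (by simpa using hi)

theorem IsPredictable.apply_zero_eq {c : Fin (T + 1) → (Fin (T + 1) → ℝ) → ℝ}
    (hc : IsPredictable c) (w : Fin (T + 1) → ℝ) : c 0 w = c 0 0 :=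
  hc _ _ _ fun i hi => absurd hi (Fin.not_lt_zero i)

@[fun_prop]
theorem measurable_shiftDensity {Ω : Type*} [MeasurableSpace Ω] {c : Ω → Fin T → (Fin T → ℝ) → ℝ}
    {w : Ω → Fin T → ℝ} (hc : ∀ t, Measurable fun a => c a t (w a)) (hw : Measurable w) :
    Measurable fun a => shiftDensity (c a) (w a) := by
  have hw' (t : Fin T) : Measurable fun a => w a t := (measurable_pi_apply t).comp hw
  exact (Real.measurable_exp.comp <| Finset.measurable_sum _ fun t _ =>
    ((hc t).mul (hw' t)).sub (((hc t).pow_const 2).div_const 2)).ennreal_ofReal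

theorem shiftDensity_cons {c : Fin (T + 1) → (Fin (T + 1) → ℝ) → ℝ} (hc : IsPredictable c)
    (a : ℝ) (w : Fin T → ℝ) :
    shiftDensity c (Fin.cons a w) =
      shiftDensity (fun t w => c t.succ (Fin.cons a w)) w *
        ENNReal.ofReal (Real.exp (c 0 0 * a - c 0 0 ^ 2 / 2)) := by
  rw [shiftDensity, shiftDensity, ← ENNReal.ofReal_mul (Real.exp_nonneg _), ← Real.exp_add,
    Fin.sum_univ_succ, hc.apply_zero_eq, add_comm]
  simp only [Fin.cons_zero, Fin.cons_succ]

@[fun_prop]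
theorem measurable_finCons {α : Type*} [MeasurableSpace α] :
    Measurable fun p : α × (Fin T → α) => (Fin.cons p.1 p.2 : Fin (T + 1) → α) := by
  refine measurable_pi_iff.2 (Fin.cases ?_ fun j => ?_)
  · simpa only [Fin.cons_zero] using measurable_fst
  · simpa only [Fin.cons_succ, Function.comp_def] using (measurable_pi_apply j).comp measurable_snd

theorem measurable_finCons_right {α : Type*} [MeasurableSpace α] (a : α) :
    Measurable fun w : Fin T → α => (Fin.cons a w : Fin (T + 1) → α) :=
  measurable_finCons.comp measurable_prodMk_left

theorem lintegral_gaussianSeq_succ {G : (Fin (T + 1) → ℝ) → ℝ≥0∞} (hG : Measurable G) :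
    ∫⁻ w, G w ∂gaussianSeq (T + 1) =
      ∫⁻ a, ∫⁻ w, G (Fin.cons a w) ∂gaussianSeq T ∂gaussianReal 0 1 := by
  have h := (measurePreserving_piFinSuccAbove (fun _ : Fin (T + 1) => gaussianReal 0 1) 0).symm
  rw [← h.lintegral_comp hG]
  refine (lintegral_prod _ (hG.comp h.measurable).aemeasurable).trans ?_
  simp [MeasurableEquiv.piFinSuccAbove_symm_apply, Fin.insertNthEquiv, Fin.insertNth_zero']

theorem gaussianPDF_sub_eq_mul_exp (c x : ℝ) :
    gaussianPDF 0 1 (x - c) =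
      gaussianPDF 0 1 x * ENNReal.ofReal (Real.exp (c * x - c ^ 2 / 2)) := by
  rw [gaussianPDF_def, ← ENNReal.ofReal_mul (gaussianPDFReal_nonneg _ _ _), gaussianPDFReal_def]
  simp only [mul_assoc, ← Real.exp_add, NNReal.coe_one]
  congr 3
  ring

theorem lintegral_gaussianReal_eq_lintegral_sub {H : ℝ → ℝ≥0∞} (hH : Measurable H) (c : ℝ) :
    ∫⁻ x, H x ∂gaussianReal 0 1 =
      ∫⁻ x, H (x - c) * ENNReal.ofReal (Real.exp (c * x - c ^ 2 / 2)) ∂gaussianReal 0 1 := by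
  have hp : Measurable (gaussianPDF 0 1) := measurable_gaussianPDF 0 1
  rw [gaussianReal_of_var_ne_zero 0 one_ne_zero, lintegral_withDensity_eq_lintegral_mul _ hp hH,
    lintegral_withDensity_eq_lintegral_mul _ hp (by fun_prop), ← lintegral_sub_right_eq_self _ c]
  refine lintegral_congr fun x => ?_
  simp only [Pi.mul_apply, gaussianPDF_sub_eq_mul_exp]
  ring

theorem lintegral_enorm_sq_gaussianReal (b : ℝ) (v : ℝ≥0) :
    ∫⁻ x, ‖x‖ₑ ^ 2 ∂gaussianReal b v = ‖b‖ₑ ^ 2 + v := by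
  have hL : MemLp (fun x : ℝ => x) 2 (gaussianReal b v) := memLp_id_gaussianReal 2
  have hsq : ∫ x, x ^ 2 ∂gaussianReal b v = b ^ 2 + v := by
    have h := variance_eq_sub hL
    simp only [variance_fun_id_gaussianReal, Pi.pow_apply, integral_id_gaussianReal] at h
    linarith
  have henorm (x : ℝ) : ‖x‖ₑ ^ 2 = ENNReal.ofReal (x ^ 2) := by
    rw [← enorm_pow, Real.enorm_of_nonneg (sq_nonneg x)]
  simp only [henorm]
  rw [← ofReal_integral_eq_lintegral_ofReal hL.integrable_sq (ae_of_all _ sq_nonneg), hsq,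
    ENNReal.ofReal_add (sq_nonneg b) v.coe_nonneg, ENNReal.ofReal_coe_nnreal]

theorem lintegral_enorm_add_mul_sq_gaussianReal (b c : ℝ) :
    ∫⁻ x, ‖b + c * x‖ₑ ^ 2 ∂gaussianReal 0 1 = ‖b‖ₑ ^ 2 + ‖c‖ₑ ^ 2 := by
  have hlaw : HasLaw (fun x : ℝ => b + c * x) (gaussianReal b (.mk (c ^ 2) (sq_nonneg c)))
      (gaussianReal 0 1) := by
    simpa using
      gaussianReal_const_add (gaussianReal_const_mul (HasLaw.id (μ := gaussianReal 0 1)) c) b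
  rw [hlaw.lintegral_comp (f := fun y : ℝ => ‖y‖ₑ ^ 2) (by fun_prop),
    lintegral_enorm_sq_gaussianReal, ← enorm_pow c, Real.enorm_of_nonneg (sq_nonneg c)]
  congr 1
  exact (ENNReal.ofReal_eq_coe_nnreal _).symm

/-- A discrete Cameron-Martin-Girsanov formula. -/
theorem lintegral_gaussianSeq_eq_lintegral_sub {c : Fin T → (Fin T → ℝ) → ℝ}
    (hc : IsPredictable c) (hm : ∀ t, Measurable (c t)) {G : (Fin T → ℝ) → ℝ≥0∞}
    (hG : Measurable G) :
    ∫⁻ w, G w ∂gaussianSeq T =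
      ∫⁻ w, G (fun t => w t - c t w) * shiftDensity c w ∂gaussianSeq T := by
  induction T with
  | zero =>
    refine lintegral_congr fun w => ?_
    rw [Subsingleton.elim (fun t => w t - c t w) w]
    simp [shiftDensity]
  | succ T ih =>
    have hcons (a : ℝ) (w : Fin T → ℝ) :
        (fun t => (Fin.cons a w : Fin (T + 1) → ℝ) t - c t (Fin.cons a w)) =
          Fin.cons (a - c 0 0) fun t => w t - c t.succ (Fin.cons a w) := by
      refine funext (Fin.cases ?_ fun t => ?_)
      · simp only [Fin.cons_zero, hc.apply_zero_eq]
      · simp only [Fin.cons_succ]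
    have hmcons (a : ℝ) (t : Fin T) : Measurable fun w : Fin T → ℝ => c t.succ (Fin.cons a w) :=
      (hm _).comp (measurable_finCons_right a)
    rw [lintegral_gaussianSeq_succ hG, lintegral_gaussianSeq_succ (by fun_prop)]
    refine (lintegral_gaussianReal_eq_lintegral_sub
      (hG.comp measurable_finCons).lintegral_prod_right' (c 0 0)).trans ?_
    refine lintegral_congr fun a => ?_
    have hGa := hG.comp (measurable_finCons_right (T := T) (a - c 0 0))
    simp only [Function.comp_apply, hcons, shiftDensity_cons hc, ← mul_assoc]
    rw [lintegral_mul_const' _ _ ENNReal.ofReal_ne_top]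
    exact congrArg (· * _) (ih (hc.comp_cons a) (hmcons a) hGa)

/-- The increments of a Gaussian martingale transform are orthogonal. -/
theorem lintegral_enorm_add_sum_mul_sq_gaussianSeq {c : Fin T → (Fin T → ℝ) → ℝ}
    (hc : IsPredictable c) (hm : ∀ t, Measurable (c t)) (b : ℝ) :
    ∫⁻ w, ‖b + ∑ t, c t w * w t‖ₑ ^ 2 ∂gaussianSeq T =
      ‖b‖ₑ ^ 2 + ∫⁻ w, ∑ t, ‖c t w‖ₑ ^ 2 ∂gaussianSeq T := by
  induction T generalizing b with
  | zero => simp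
  | succ T ih =>
    have hmcons (a : ℝ) (t : Fin T) : Measurable fun w : Fin T → ℝ => c t.succ (Fin.cons a w) :=
      (hm _).comp (measurable_finCons_right a)
    rw [lintegral_gaussianSeq_succ (by fun_prop), lintegral_gaussianSeq_succ (by fun_prop)]
    simp only [Fin.sum_univ_succ, hc.apply_zero_eq, Fin.cons_zero, Fin.cons_succ, ← add_assoc,
      lintegral_add_left measurable_const, ih (hc.comp_cons _) (hmcons _)]
    rw [lintegral_add_left (by fun_prop), lintegral_enorm_add_mul_sq_gaussianReal]
    simp only [lintegral_const, measure_univ, mul_one, add_assoc]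

end GaussianShift

section TwoPointBound

variable {T : ℕ}

theorem one_le_two_mul_min_one_exp_add (S : ℝ) {Q : ℝ} (hQ : 0 ≤ Q) :
    1 ≤ 2 * min 1 (Real.exp (S - Q / 2)) + (S ^ 2 + Q) := by
  have hexp := Real.add_one_le_exp (S - Q / 2)
  rcases le_total 1 (Real.exp (S - Q / 2)) with h | h
  · rw [min_eq_left h]
    linarith [sq_nonneg S]
  · rw [min_eq_right h]
    linarith [sq_nonneg (S + 1)]

theorem one_le_two_mul_min_one_shiftDensity_add (c : Fin T → (Fin T → ℝ) → ℝ) (w : Fin T → ℝ) :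
    1 ≤ 2 * min 1 (shiftDensity c w) +
      (‖∑ t, c t w * w t‖ₑ ^ 2 + ∑ t, ‖c t w‖ₑ ^ 2) := by
  have hsq (x : ℝ) : ‖x‖ₑ ^ 2 = ENNReal.ofReal (x ^ 2) := by
    rw [← enorm_pow, Real.enorm_of_nonneg (sq_nonneg x)]
  have hQ : 0 ≤ ∑ t, c t w ^ 2 := Finset.sum_nonneg fun t _ => sq_nonneg _
  have hmin : 0 ≤ min 1 (Real.exp (∑ t, c t w * w t - (∑ t, c t w ^ 2) / 2)) :=
    le_min zero_le_one (Real.exp_nonneg _)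
  simp only [hsq, ← ENNReal.ofReal_sum_of_nonneg fun t _ => sq_nonneg (c t w)]
  rw [shiftDensity, Finset.sum_sub_distrib, ← Finset.sum_div, ← ENNReal.ofReal_one,
    ← ENNReal.ofReal_min, ← ENNReal.ofReal_ofNat 2, ← ENNReal.ofReal_mul zero_le_two,
    ← ENNReal.ofReal_add (sq_nonneg _) hQ,
    ← ENNReal.ofReal_add (mul_nonneg zero_le_two hmin) (add_nonneg (sq_nonneg _) hQ)]
  exact ENNReal.ofReal_le_ofReal (one_le_two_mul_min_one_exp_add _ hQ)

theorem le_two_mul_add_mul_of_one_le {B x y l q : ℝ≥0∞} (hB : B ≤ x + y)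
    (hq : 1 ≤ 2 * min 1 l + q) : B ≤ 2 * (x + y * l) + B * q := by
  have hmin : B * min 1 l ≤ x + y * l := calc
    B * min 1 l ≤ (x + y) * min 1 l := by gcongr
    _ = x * min 1 l + y * min 1 l := add_mul _ _ _
    _ ≤ x * 1 + y * l := by gcongr <;> [exact min_le_left _ _; exact min_le_right _ _]
    _ = x + y * l := by rw [mul_one]
  calc B = B * 1 := (mul_one B).symm
    _ ≤ B * (2 * min 1 l + q) := by gcongr
    _ = 2 * (B * min 1 l) + B * q := by ring
    _ ≤ 2 * (x + y * l) + B * q := by gcongr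

variable {Ω : Type*} [MeasurableSpace Ω] {ν : Measure Ω} {c : Ω → Fin T → (Fin T → ℝ) → ℝ}

theorem lintegral_prod_gaussianSeq_eq_lintegral_sub [SFinite ν] (hc : ∀ a, IsPredictable (c a))
    (hm : ∀ t, Measurable fun p : Ω × (Fin T → ℝ) => c p.1 t p.2)
    {G : Ω × (Fin T → ℝ) → ℝ≥0∞} (hG : Measurable G) :
    ∫⁻ p, G p ∂ν.prod (gaussianSeq T) =
      ∫⁻ p, G (p.1, fun t => p.2 t - c p.1 t p.2) * shiftDensity (c p.1) p.2
        ∂ν.prod (gaussianSeq T) := by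
  have hsub : Measurable fun p : Ω × (Fin T → ℝ) => fun t => p.2 t - c p.1 t p.2 :=
    measurable_pi_iff.2 fun t => (by fun_prop : Measurable fun p : Ω × (Fin T → ℝ) => p.2 t).sub
      (hm t)
  have hGsub : Measurable fun p : Ω × (Fin T → ℝ) =>
      G (p.1, fun t => p.2 t - c p.1 t p.2) * shiftDensity (c p.1) p.2 :=
    (hG.comp (measurable_fst.prodMk hsub)).mul (measurable_shiftDensity hm measurable_snd)
  rw [lintegral_prod _ hG.aemeasurable, lintegral_prod _ hGsub.aemeasurable]
  exact lintegral_congr fun a => lintegral_gaussianSeq_eq_lintegral_sub (hc a)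
    (fun t => (hm t).comp measurable_prodMk_left) (hG.comp measurable_prodMk_left)

theorem lintegral_enorm_sum_mul_sq_prod_gaussianSeq [SFinite ν] (hc : ∀ a, IsPredictable (c a))
    (hm : ∀ t, Measurable fun p : Ω × (Fin T → ℝ) => c p.1 t p.2) :
    ∫⁻ p, ‖∑ t, c p.1 t p.2 * p.2 t‖ₑ ^ 2 ∂ν.prod (gaussianSeq T) =
      ∫⁻ p, ∑ t, ‖c p.1 t p.2‖ₑ ^ 2 ∂ν.prod (gaussianSeq T) := by
  rw [lintegral_prod _ (by fun_prop), lintegral_prod _ (by fun_prop)]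
  refine lintegral_congr fun a => ?_
  simpa using lintegral_enorm_add_sum_mul_sq_gaussianSeq (hc a)
    (fun t => (hm t).comp measurable_prodMk_left) 0

/-- Le Cam's two-point method; the log-likelihood ratio is controlled through its second moment. -/
theorem le_two_mul_lintegral_add_of_le_add_shift [IsProbabilityMeasure ν]
    (hc : ∀ a, IsPredictable (c a))
    (hm : ∀ t, Measurable fun p : Ω × (Fin T → ℝ) => c p.1 t p.2)
    {F₀ F₁ : Ω × (Fin T → ℝ) → ℝ≥0∞} (hF₀ : Measurable F₀) (hF₁ : Measurable F₁) {B : ℝ≥0∞}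
    (hB : ∀ p, B ≤ F₀ p + F₁ (p.1, fun t => p.2 t - c p.1 t p.2)) :
    B ≤ 2 * (∫⁻ p, F₀ p ∂ν.prod (gaussianSeq T) + ∫⁻ p, F₁ p ∂ν.prod (gaussianSeq T)) +
      B * (2 * ∫⁻ p, ∑ t, ‖c p.1 t p.2‖ₑ ^ 2 ∂ν.prod (gaussianSeq T)) := by
  let F₁' (p : Ω × (Fin T → ℝ)) : ℝ≥0∞ :=
    F₁ (p.1, fun t => p.2 t - c p.1 t p.2) * shiftDensity (c p.1) p.2
  let S (p : Ω × (Fin T → ℝ)) : ℝ≥0∞ := ‖∑ t, c p.1 t p.2 * p.2 t‖ₑ ^ 2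
  let Q (p : Ω × (Fin T → ℝ)) : ℝ≥0∞ := ∑ t, ‖c p.1 t p.2‖ₑ ^ 2
  have hQ : Measurable Q := by fun_prop
  have hSQ : Measurable fun p => B * (S p + Q p) := by fun_prop
  calc B = ∫⁻ _, B ∂ν.prod (gaussianSeq T) := by simp
    _ ≤ ∫⁻ p, (2 * (F₀ p + F₁' p) + B * (S p + Q p)) ∂ν.prod (gaussianSeq T) :=
      lintegral_mono fun p => le_two_mul_add_mul_of_one_le (hB p)
        (one_le_two_mul_min_one_shiftDensity_add (c p.1) p.2)
    _ = _ := by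
      rw [lintegral_add_right _ hSQ, lintegral_const_mul' _ _ ENNReal.ofNat_ne_top,
        lintegral_const_mul _ (by fun_prop), lintegral_add_left hF₀, lintegral_add_right _ hQ,
        lintegral_enorm_sum_mul_sq_prod_gaussianSeq hc hm, ← two_mul,
        ← lintegral_prod_gaussianSeq_eq_lintegral_sub hc hm hF₁]

end TwoPointBound

section History

variable {K m n T : ℕ} {U : Type*} [MeasurableSpace U]

@[fun_prop]
theorem measurable_finSnoc {α : Type*} [MeasurableSpace α] {t : ℕ} :
    Measurable fun p : (Fin t → α) × α => (Fin.snoc p.1 p.2 : Fin (t + 1) → α) := by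
  refine measurable_pi_iff.2 (Fin.lastCases ?_ fun j => ?_)
  · simpa only [Fin.snoc_last] using measurable_snd
  · simpa only [Fin.snoc_castSucc, Function.comp_def] using
      (measurable_pi_apply j).comp measurable_fst

theorem continuous_response (q : Matrix (Fin m) (Fin n) ℝ × EuclideanSpace ℝ (Fin m)) :
    Continuous (response q) := by
  unfold response
  fun_prop

theorem measurable_response_uncurry (θ : Param K m n) :
    Measurable fun p : EuclideanSpace ℝ (Fin n) × Fin K => response (θ p.2) p.1 :=
  measurable_from_prod_countable_left fun j => (continuous_response (θ j)).measurable

theorem measurable_history (θ : Param K m n) (μ : CausalRule K m n U) (t : ℕ) (h : t ≤ T) :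
    Measurable fun ω : U × (Fin (T + 1) → Fin K) × (Fin T → EuclideanSpace ℝ (Fin m)) =>
      history θ μ ω.1 ω.2.1 ω.2.2 t h := by
  induction t with
  | zero =>
    unfold history
    fun_prop
  | succ t ih =>
    specialize ih (Nat.le_of_succ_le h)
    have hinput := (μ.measurable_toFun t).comp (measurable_fst.prodMk ih)
    have hstate : Measurable fun ω : U × (Fin (T + 1) → Fin K) ×
        (Fin T → EuclideanSpace ℝ (Fin m)) => ω.2.1 ⟨t + 1, Nat.lt_succ_of_le h⟩ := by fun_prop
    have hnoise : Measurable fun ω : U × (Fin (T + 1) → Fin K) ×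
        (Fin T → EuclideanSpace ℝ (Fin m)) => ω.2.2 ⟨t, h⟩ := by fun_prop
    have houtput := ((measurable_response_uncurry θ).comp (hinput.prodMk hstate)).add hnoise
    exact (measurable_finSnoc.comp (ih.fst.prodMk hinput)).prodMk <|
      (measurable_finSnoc.comp (ih.snd.fst.prodMk houtput)).prodMk <|
        measurable_finSnoc.comp (ih.snd.snd.prodMk hstate)

theorem history_congr (θ : Param K m n) (μ : CausalRule K m n U) (u : U)
    (s : Fin (T + 1) → Fin K) {w w' : Fin T → EuclideanSpace ℝ (Fin m)} (t : ℕ) (h : t ≤ T)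
    (hw : ∀ i : Fin T, i.1 < t → w i = w' i) :
    history θ μ u s w t h = history θ μ u s w' t h := by
  induction t with
  | zero => rfl
  | succ t ih =>
    simp only [history, ih (Nat.le_of_succ_le h) fun i hi => hw i (hi.trans t.lt_succ_self),
      hw ⟨t, h⟩ t.lt_succ_self]

/-- The input or the estimate that the rule `est` produces for period `t + 1` from the data
generated by the policy `μ` on the system `θ`, when `ω` collects the seed, the states and the
noises. -/
def decision (θ : Param K m n) (μ est : CausalRule K m n U)
    (ω : U × (Fin (T + 1) → Fin K) × (Fin T → EuclideanSpace ℝ (Fin m))) (t : Fin T) :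
    EuclideanSpace ℝ (Fin n) :=
  est.toFun t (ω.1, history θ μ ω.1 ω.2.1 ω.2.2 t t.isLt.le)

@[fun_prop]
theorem measurable_decision (θ : Param K m n) (μ est : CausalRule K m n U) (t : Fin T) :
    Measurable fun ω => decision θ μ est ω t :=
  (est.measurable_toFun t).comp (measurable_fst.prodMk (measurable_history θ μ t t.isLt.le))

theorem decision_congr (θ : Param K m n) (μ est : CausalRule K m n U) (u : U)
    (s : Fin (T + 1) → Fin K) {w w' : Fin T → EuclideanSpace ℝ (Fin m)} {t : Fin T}
    (hw : ∀ i < t, w i = w' i) : decision θ μ est (u, s, w) t = decision θ μ est (u, s, w') t := by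
  simp only [decision, history_congr θ μ u s t t.isLt.le hw]

theorem history_eq_of_response_add_eq {θ θ' : Param K m n} (μ : CausalRule K m n U) (u : U)
    (s : Fin (T + 1) → Fin K) {w w' : Fin T → EuclideanSpace ℝ (Fin m)}
    (hw : ∀ t : Fin T, response (θ' (s t.succ)) (decision θ μ μ (u, s, w) t) + w' t =
      response (θ (s t.succ)) (decision θ μ μ (u, s, w) t) + w t) (t : ℕ) (h : t ≤ T) :
    history θ' μ u s w' t h = history θ μ u s w t h := by
  induction t with
  | zero => rfl
  | succ t ih =>
    have houtput := hw ⟨t, h⟩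
    simp only [decision, Fin.succ_mk] at houtput
    simp only [history, ih, houtput]

theorem decision_eq_of_response_add_eq {θ θ' : Param K m n} (μ est : CausalRule K m n U) (u : U)
    (s : Fin (T + 1) → Fin K) {w w' : Fin T → EuclideanSpace ℝ (Fin m)}
    (hw : ∀ t : Fin T, response (θ' (s t.succ)) (decision θ μ μ (u, s, w) t) + w' t =
      response (θ (s t.succ)) (decision θ μ μ (u, s, w) t) + w t) (t : Fin T) :
    decision θ' μ est (u, s, w') t = decision θ μ est (u, s, w) t := by
  simp only [decision, history_eq_of_response_add_eq μ u s hw]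

end History

section SystemLaw

variable {K m T : ℕ} {U : Type*} [MeasurableSpace U]

theorem pathProb_nonneg {π : Fin K → ℝ} (hπ : π ∈ stdSimplex ℝ (Fin K))
    {P : Matrix (Fin K) (Fin K) ℝ} (hP : P ∈ rowStochastic ℝ (Fin K)) (s : Fin (T + 1) → Fin K) :
    0 ≤ pathProb π P s :=
  mul_nonneg (hπ.1 _) (Finset.prod_nonneg fun _ _ => hP.1 _ _)

theorem pathProb_cons (π : Fin K → ℝ) (P : Matrix (Fin K) (Fin K) ℝ) (i : Fin K)
    (s : Fin (T + 1) → Fin K) :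
    pathProb π P (Fin.cons i s : Fin (T + 2) → Fin K) = π i * pathProb (P i) P s := by
  simp only [pathProb, Fin.prod_univ_succ, Fin.castSucc_zero, Fin.cons_zero, Fin.cons_succ,
    Fin.castSucc_succ]

theorem sum_pathProb {π : Fin K → ℝ} (hπ : π ∈ stdSimplex ℝ (Fin K))
    {P : Matrix (Fin K) (Fin K) ℝ} (hP : P ∈ rowStochastic ℝ (Fin K)) :
    ∑ s : Fin (T + 1) → Fin K, pathProb π P s = 1 := by
  induction T generalizing π with
  | zero =>
    rw [← (Equiv.funUnique (Fin 1) (Fin K)).symm.sum_comp]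
    simpa [pathProb] using hπ.2
  | succ T ih =>
    have hrow (i : Fin K) : P i ∈ stdSimplex ℝ (Fin K) :=
      ⟨hP.1 i, sum_row_of_mem_rowStochastic hP i⟩
    rw [← (Fin.consEquiv fun _ : Fin (T + 2) => Fin K).sum_comp, Fintype.sum_prod_type]
    simp only [Fin.consEquiv, Equiv.coe_fn_mk, pathProb_cons, ← Finset.mul_sum, ih (hrow _),
      mul_one, hπ.2]

/-- The law of the state path `s_0, …, s_T`. -/
noncomputable def pathLaw (T : ℕ) (π : Fin K → ℝ) (P : Matrix (Fin K) (Fin K) ℝ) :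
    Measure (Fin (T + 1) → Fin K) :=
  Measure.sum fun s => ENNReal.ofReal (pathProb π P s) • Measure.dirac s

theorem isProbabilityMeasure_pathLaw {π : Fin K → ℝ} (hπ : π ∈ stdSimplex ℝ (Fin K))
    {P : Matrix (Fin K) (Fin K) ℝ} (hP : P ∈ rowStochastic ℝ (Fin K)) :
    IsProbabilityMeasure (pathLaw T π P) := by
  refine ⟨?_⟩
  simp only [pathLaw, Measure.sum_apply _ MeasurableSet.univ, Measure.smul_apply, measure_univ,
    smul_eq_mul, mul_one, tsum_fintype]
  rw [← ENNReal.ofReal_sum_of_nonneg fun s _ => pathProb_nonneg hπ hP s, sum_pathProb hπ hP,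
    ENNReal.ofReal_one]

theorem systemLaw_const (ρ : Measure U) [SFinite ρ] (π : Fin K → ℝ) (P : Matrix (Fin K) (Fin K) ℝ)
    (f : Measure (EuclideanSpace ℝ (Fin m))) [SigmaFinite f] :
    systemLaw T ρ π P (fun _ => f) =
      ρ.prod ((pathLaw T π P).prod (Measure.pi fun _ : Fin T => f)) := by
  rw [systemLaw, pathLaw, Measure.prod_sum_left, Measure.prod_sum_right, Measure.sum_fintype]
  simp only [Measure.prod_smul_left, Measure.prod_smul_right]

/-- The law of `g • r` for a standard Gaussian variable `g`: the noise of the hard instances. -/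
noncomputable def lineGaussian (r : EuclideanSpace ℝ (Fin m)) :
    Measure (EuclideanSpace ℝ (Fin m)) :=
  (gaussianReal 0 1).map fun g => g • r

instance (r : EuclideanSpace ℝ (Fin m)) : IsProbabilityMeasure (lineGaussian r) :=
  Measure.isProbabilityMeasure_map (by fun_prop)

theorem measurePreserving_systemLaw_lineGaussian (ρ : Measure U) [SFinite ρ] (π : Fin K → ℝ)
    (P : Matrix (Fin K) (Fin K) ℝ) (r : EuclideanSpace ℝ (Fin m)) :
    MeasurePreserving
      (fun p : (U × (Fin (T + 1) → Fin K)) × (Fin T → ℝ) => (p.1.1, p.1.2, fun t => p.2 t • r))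
      ((ρ.prod (pathLaw T π P)).prod (gaussianSeq T))
      (systemLaw T ρ π P fun _ => lineGaussian r) := by
  have hline : MeasurePreserving (fun g : Fin T → ℝ => fun t => g t • r) (gaussianSeq T)
      (Measure.pi fun _ => lineGaussian r) :=
    measurePreserving_pi (f := fun (_ : Fin T) g => g • r) _ (fun _ => lineGaussian r)
      fun _ => ⟨by fun_prop, rfl⟩
  rw [systemLaw_const]
  exact ((MeasurePreserving.id ρ).prod ((MeasurePreserving.id _).prod hline)).comp
    ⟨MeasurableEquiv.prodAssoc.measurable, Measure.prodAssoc_prod⟩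

end SystemLaw

section TwoSystems

theorem enorm_sub_sq_le_two_mul_add {E : Type*} [SeminormedAddCommGroup E] (a x y : E) :
    ‖x - y‖ₑ ^ 2 ≤ 2 * (‖a - x‖ₑ ^ 2 + ‖a - y‖ₑ ^ 2) := by
  have htri : ‖x - y‖₊ ≤ ‖a - y‖₊ + ‖a - x‖₊ := by
    simpa only [sub_sub_sub_cancel_left] using nnnorm_sub_le (a - y) (a - x)
  have hsq : ‖x - y‖₊ ^ 2 ≤ 2 * (‖a - x‖₊ ^ 2 + ‖a - y‖₊ ^ 2) := by
    rw [add_comm (‖a - x‖₊ ^ 2)]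
    exact (pow_le_pow_left₀ zero_le htri 2).trans add_sq_le
  simp only [enorm_eq_nnnorm]
  exact_mod_cast hsq

variable {K m n T : ℕ} {U : Type*} [MeasurableSpace U] {ystar : EuclideanSpace ℝ (Fin m)}
  {P : Matrix (Fin K) (Fin K) ℝ} {θ θ' : Param K m n}

/-- The squared error of the decisions of `est` over the whole horizon, on the sample point `ω`. -/
noncomputable def squaredError (ystar : EuclideanSpace ℝ (Fin m)) (θ : Param K m n)
    (P : Matrix (Fin K) (Fin K) ℝ) (μ est : CausalRule K m n U)
    (ω : U × (Fin (T + 1) → Fin K) × (Fin T → EuclideanSpace ℝ (Fin m))) : ℝ≥0∞ :=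
  ∑ t : Fin T, ‖decision θ μ est ω t - optimalInput ystar θ P (ω.2.1 t.castSucc)‖ₑ ^ 2

@[fun_prop]
theorem measurable_squaredError (ystar : EuclideanSpace ℝ (Fin m)) (θ : Param K m n)
    (P : Matrix (Fin K) (Fin K) ℝ) (μ est : CausalRule K m n U) :
    Measurable fun ω => squaredError (T := T) ystar θ P μ est ω := by
  unfold squaredError
  refine Finset.measurable_sum _ fun t _ => Measurable.pow_const (Measurable.enorm ?_) 2
  exact (measurable_decision θ μ est t).sub
    ((Measurable.of_discrete (f := optimalInput ystar θ P)).comp (by fun_prop))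

theorem cumulativeMSE_lineGaussian (ystar : EuclideanSpace ℝ (Fin m)) (θ : Param K m n)
    (ρ : Measure U) [SFinite ρ] (π : Fin K → ℝ) (P : Matrix (Fin K) (Fin K) ℝ)
    (μ est : CausalRule K m n U) (r : EuclideanSpace ℝ (Fin m)) :
    cumulativeMSE T ystar ρ π μ est θ P (fun _ => lineGaussian r) =
      ∫⁻ p, squaredError ystar θ P μ est (p.1.1, p.1.2, fun t : Fin T => p.2 t • r)
        ∂(ρ.prod (pathLaw T π P)).prod (gaussianSeq T) :=
  ((measurePreserving_systemLaw_lineGaussian ρ π P r).lintegral_comp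
    (measurable_squaredError ystar θ P μ est)).symm

variable {ρ : Measure U} [IsProbabilityMeasure ρ] {π : Fin K → ℝ} {d : ℝ≥0∞}

theorem mul_le_two_mul_squaredError_add
    (hsep : ∀ i, d ≤ ‖optimalInput ystar θ P i - optimalInput ystar θ' P i‖ₑ ^ 2)
    (μ est : CausalRule K m n U) (u : U) (s : Fin (T + 1) → Fin K)
    {w w' : Fin T → EuclideanSpace ℝ (Fin m)}
    (hw : ∀ t : Fin T, response (θ' (s t.succ)) (decision θ μ μ (u, s, w) t) + w' t =
      response (θ (s t.succ)) (decision θ μ μ (u, s, w) t) + w t) :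
    T * d ≤
      2 * (squaredError ystar θ P μ est (u, s, w) + squaredError ystar θ' P μ est (u, s, w')) := by
  rw [squaredError, squaredError, ← Finset.sum_add_distrib, Finset.mul_sum]
  simp only [decision_eq_of_response_add_eq μ est u s hw]
  calc (T : ℝ≥0∞) * d = ∑ _ : Fin T, d := by simp
    _ ≤ _ := Finset.sum_le_sum fun t _ => (hsep _).trans (enorm_sub_sq_le_two_mul_add _ _ _)

/-- The noise can hide the difference of the two systems at the cost of a predictable shift, whose
energy is controlled by the distance of the inputs from the optimal ones. -/
theorem mul_le_four_mul_cumulativeMSE_add (hπ : π ∈ stdSimplex ℝ (Fin K))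
    (hP : P ∈ rowStochastic ℝ (Fin K)) (μ est : CausalRule K m n U)
    (hsep : ∀ i, d ≤ ‖optimalInput ystar θ P i - optimalInput ystar θ' P i‖ₑ ^ 2)
    {r : EuclideanSpace ℝ (Fin m)} {φ : Fin K → EuclideanSpace ℝ (Fin n) → ℝ}
    (hφ : ∀ j, Measurable (φ j)) (hresp : ∀ j z, response (θ' j) z = response (θ j) z + φ j z • r)
    {M : ℝ≥0∞} (hφM : ∀ i j z, ‖φ j z‖ₑ ^ 2 ≤ M * ‖z - optimalInput ystar θ P i‖ₑ ^ 2) :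
    T * d ≤ 4 * (cumulativeMSE T ystar ρ π μ est θ P (fun _ => lineGaussian r) +
        cumulativeMSE T ystar ρ π μ est θ' P (fun _ => lineGaussian r)) +
      T * d * (2 * (M * cumulativeMSE T ystar ρ π μ μ θ P (fun _ => lineGaussian r))) := by
  have := isProbabilityMeasure_pathLaw (T := T) hπ hP
  have hmeas := (measurePreserving_systemLaw_lineGaussian (T := T) ρ π P r).measurable
  let c (a : U × (Fin (T + 1) → Fin K)) (t : Fin T) (g : Fin T → ℝ) : ℝ :=
    φ (a.2 t.succ) (decision θ μ μ (a.1, a.2, fun t => g t • r) t)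
  have hc (a) : IsPredictable (c a) := fun t g g' h =>
    congrArg (φ _) (decision_congr θ μ μ a.1 a.2 fun i hi => by rw [h i hi])
  have hcm (t : Fin T) :
      Measurable fun p : (U × (Fin (T + 1) → Fin K)) × (Fin T → ℝ) => c p.1 t p.2 :=
    (measurable_from_prod_countable_left hφ : Measurable fun q :
      EuclideanSpace ℝ (Fin n) × Fin K => φ q.2 q.1).comp
      (((measurable_decision θ μ μ t).comp hmeas).prodMk (by fun_prop))
  have hhide (p : (U × (Fin (T + 1) → Fin K)) × (Fin T → ℝ)) (t : Fin T) :
      response (θ' (p.1.2 t.succ)) (decision θ μ μ (p.1.1, p.1.2, fun t => p.2 t • r) t) +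
          (p.2 t - c p.1 t p.2) • r =
        response (θ (p.1.2 t.succ)) (decision θ μ μ (p.1.1, p.1.2, fun t => p.2 t • r) t) +
          p.2 t • r := by
    rw [hresp, sub_smul, add_assoc, add_sub_cancel]
  have henergy : ∫⁻ p, ∑ t, ‖c p.1 t p.2‖ₑ ^ 2 ∂(ρ.prod (pathLaw T π P)).prod (gaussianSeq T) ≤
      M * cumulativeMSE T ystar ρ π μ μ θ P (fun _ => lineGaussian r) := by
    rw [cumulativeMSE_lineGaussian, ← lintegral_const_mul M (by fun_prop)]
    refine lintegral_mono fun p => ?_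
    simp only [squaredError, Finset.mul_sum]
    exact Finset.sum_le_sum fun t _ => hφM _ _ _
  have htwoPoint := le_two_mul_lintegral_add_of_le_add_shift (ν := ρ.prod (pathLaw T π P)) hc hcm
    (((measurable_squaredError ystar θ P μ est).comp hmeas).const_mul 2)
    (((measurable_squaredError ystar θ' P μ est).comp hmeas).const_mul 2)
    fun p => (mul_le_two_mul_squaredError_add hsep μ est p.1.1 p.1.2 (hhide p)).trans_eq
      (mul_add _ _ _)
  simp only [Function.comp_apply] at htwoPoint
  rw [lintegral_const_mul 2 (by fun_prop), lintegral_const_mul 2 (by fun_prop),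
    ← cumulativeMSE_lineGaussian, ← cumulativeMSE_lineGaussian, ← mul_add, ← mul_assoc] at htwoPoint
  refine htwoPoint.trans ?_
  norm_num
  gcongr

/-- Nothing is observed before the first decision. -/
theorem le_two_mul_cumulativeMSE_add (hT : 0 < T) (hπ : π ∈ stdSimplex ℝ (Fin K))
    (hP : P ∈ rowStochastic ℝ (Fin K)) (μ est : CausalRule K m n U)
    (hsep : ∀ i, d ≤ ‖optimalInput ystar θ P i - optimalInput ystar θ' P i‖ₑ ^ 2)
    (r : EuclideanSpace ℝ (Fin m)) :
    d ≤ 2 * (cumulativeMSE T ystar ρ π μ est θ P (fun _ => lineGaussian r) +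
      cumulativeMSE T ystar ρ π μ est θ' P (fun _ => lineGaussian r)) := by
  have := isProbabilityMeasure_pathLaw (T := T) hπ hP
  have hfirst (ω : U × (Fin (T + 1) → Fin K) × (Fin T → EuclideanSpace ℝ (Fin m))) :
      d ≤ 2 * (squaredError ystar θ P μ est ω + squaredError ystar θ' P μ est ω) := by
    rw [squaredError, squaredError, ← Finset.sum_add_distrib]
    refine le_trans ?_ (mul_le_mul_right (Finset.single_le_sum (fun _ _ => zero_le)
      (Finset.mem_univ (⟨0, hT⟩ : Fin T))) 2)
    exact (hsep _).trans (enorm_sub_sq_le_two_mul_add _ _ _)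
  rw [cumulativeMSE_lineGaussian, cumulativeMSE_lineGaussian, ← lintegral_add_left (by fun_prop),
    ← lintegral_const_mul 2 (by fun_prop)]
  calc d = ∫⁻ _, d ∂(ρ.prod (pathLaw T π P)).prod (gaussianSeq T) := by simp
    _ ≤ _ := lintegral_mono fun _ => hfirst _

end TwoSystems

section Noise

variable {m : ℕ}

theorem lintegral_enorm_pow_gaussianReal_ne_top (k : ℕ) :
    ∫⁻ g, ‖g‖ₑ ^ k ∂gaussianReal 0 1 ≠ ∞ := by
  have h := (memLp_id_gaussianReal (μ := 0) (v := 1) (k : ℝ≥0)).integrable_norm_pow'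
  simpa [HasFiniteIntegral, enorm_pow] using h.2.ne

theorem lintegral_enorm_pow_lineGaussian (r : EuclideanSpace ℝ (Fin m)) (i : Fin m) (k : ℕ) :
    ∫⁻ w, ‖w i‖ₑ ^ k ∂lineGaussian r = (∫⁻ g, ‖g‖ₑ ^ k ∂gaussianReal 0 1) * ‖r i‖ₑ ^ k := by
  rw [lineGaussian, lintegral_map (by fun_prop) (by fun_prop)]
  simp only [PiLp.smul_apply, smul_eq_mul, enorm_mul, mul_pow]
  exact lintegral_mul_const _ (by fun_prop)

theorem integral_id_lineGaussian (r : EuclideanSpace ℝ (Fin m)) : ∫ w, w ∂lineGaussian r = 0 := by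
  rw [lineGaussian, integral_map (by fun_prop) (by fun_prop), integral_smul_const,
    integral_id_gaussianReal, zero_smul]

theorem eventually_isNoiseLaw_lineGaussian {σ : ℝ} (hσ : 0 < σ) :
    ∀ᶠ r : EuclideanSpace ℝ (Fin m) in 𝓝 0, IsNoiseLaw σ (lineGaussian r) := by
  have hmoment (k : ℕ) (hk : k ≠ 0) : ∀ᶠ r : EuclideanSpace ℝ (Fin m) in 𝓝 0,
      ∀ i, ∫⁻ w, ‖w i‖ₑ ^ k ∂lineGaussian r ≤ ENNReal.ofReal (σ ^ k) := by
    simp only [lintegral_enorm_pow_lineGaussian]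
    refine eventually_all.2 fun i => ?_
    have hcont : Continuous fun r : EuclideanSpace ℝ (Fin m) =>
        (∫⁻ g, ‖g‖ₑ ^ k ∂gaussianReal 0 1) * ‖r i‖ₑ ^ k :=
      (ENNReal.continuous_const_mul (lintegral_enorm_pow_gaussianReal_ne_top k)).comp (by fun_prop)
    refine hcont.continuousAt.eventually_le_const ?_
    simpa [hk] using pow_pos hσ k
  filter_upwards [hmoment 2 two_ne_zero, hmoment 4 four_ne_zero] with r hr₂ hr₄
  exact ⟨inferInstance, integral_id_lineGaussian r, hr₂, hr₄⟩

end Noise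

section Rank

variable {ι κ 𝕜 : Type*} [Fintype κ]

theorem rank_eq_card_iff_det_ne_zero [DecidableEq κ] [Field 𝕜] (A : Matrix κ κ 𝕜) :
    A.rank = Fintype.card κ ↔ A.det ≠ 0 := by
  refine ⟨fun h => ?_, rank_of_det_ne_zero⟩
  have hrange : LinearMap.range A.mulVecLin = ⊤ :=
    Submodule.eq_top_of_finrank_eq (h.trans (Module.finrank_fintype_fun_eq_card 𝕜).symm)
  exact ((isUnit_iff_isUnit_det A).1
    (mulVec_surjective_iff_isUnit.1 (LinearMap.range_eq_top.1 hrange))).ne_zero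

theorem rank_eq_card_iff_det_transpose_mul_self_ne_zero [Fintype ι] [DecidableEq κ] [Field 𝕜]
    [LinearOrder 𝕜] [IsStrictOrderedRing 𝕜] (A : Matrix ι κ 𝕜) :
    A.rank = Fintype.card κ ↔ (Aᵀ * A).det ≠ 0 := by
  rw [← rank_transpose_mul_self, rank_eq_card_iff_det_ne_zero]

theorem exists_transpose_mulVec_eq [Fintype ι] [Field 𝕜] [LinearOrder 𝕜] [IsStrictOrderedRing 𝕜]
    {A : Matrix ι κ 𝕜} (hA : A.rank = Fintype.card κ) (z : κ → 𝕜) : ∃ v, Aᵀ *ᵥ v = z := by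
  classical
  have hdet := (rank_eq_card_iff_det_transpose_mul_self_ne_zero A).1 hA
  exact ⟨A *ᵥ ((Aᵀ * A)⁻¹ *ᵥ z), by
    rw [mulVec_mulVec, mulVec_mulVec, mul_nonsing_inv _ hdet.isUnit, one_mulVec]⟩

theorem posDef_transpose_mul_self [Fintype ι] {A : Matrix ι κ ℝ} (hA : A.rank = Fintype.card κ) :
    (Aᵀ * A).PosDef := by
  classical
  have hdet := (rank_eq_card_iff_det_transpose_mul_self_ne_zero A).1 hA
  rw [← conjTranspose_eq_transpose_of_trivial] at hdet ⊢
  exact (posSemidef_conjTranspose_mul_self A).posDef_iff_isUnit.2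
    ((isUnit_iff_isUnit_det _).2 hdet.isUnit)

theorem isOpen_setOf_rank_eq_card [Finite ι] :
    IsOpen {A : Matrix ι κ ℝ | A.rank = Fintype.card κ} := by
  classical
  have := Fintype.ofFinite ι
  simp only [rank_eq_card_iff_det_transpose_mul_self_ne_zero]
  exact isOpen_ne_fun (by fun_prop) continuous_const

theorem continuousAt_inv_of_det_ne_zero [DecidableEq κ] {A : Matrix κ κ ℝ} (hA : A.det ≠ 0) :
    ContinuousAt Inv.inv A :=
  continuousAt_matrix_inv A (by simpa only [Ring.inverse_eq_inv'] using continuousAt_inv₀ hA)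

end Rank

section OptimalInput

variable {K m n : ℕ} {ystar : EuclideanSpace ℝ (Fin m)} {θ : Param K m n}
  {P : Matrix (Fin K) (Fin K) ℝ} {i : Fin K}

/-- The Gram matrix `∑_j p_{i,j} A_jᵀ A_j`, half of the Hessian of the stage cost after state `i`
as a function of the input. -/
noncomputable def gram (θ : Param K m n) (P : Matrix (Fin K) (Fin K) ℝ) (i : Fin K) :
    Matrix (Fin n) (Fin n) ℝ :=
  ∑ j, P i j • ((θ j).1ᵀ * (θ j).1)

/-- Half of the gradient, at the input `x`, of the stage cost after state `i`. -/
noncomputable def halfGradient (ystar : EuclideanSpace ℝ (Fin m)) (θ : Param K m n)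
    (P : Matrix (Fin K) (Fin K) ℝ) (i : Fin K) (x : EuclideanSpace ℝ (Fin n)) : Fin n → ℝ :=
  ∑ j, P i j • ((θ j).1ᵀ *ᵥ ofLp (response (θ j) x - ystar))

theorem posDef_gram (hθ : ∀ k, (θ k).1.rank = n) (hP : P ∈ rowStochastic ℝ (Fin K)) (i : Fin K) :
    (gram θ P i).PosDef := by
  obtain ⟨hP0, hP1⟩ := mem_rowStochastic_iff_sum.1 hP
  have hpd (j : Fin K) : ((θ j).1ᵀ * (θ j).1).PosDef :=
    posDef_transpose_mul_self (by simpa using hθ j)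
  obtain ⟨k, -, hk⟩ : ∃ k ∈ Finset.univ, 0 < P i k :=
    Finset.exists_lt_of_sum_lt (f := 0) (by simp [hP1])
  rw [gram, ← Finset.add_sum_erase _ _ (Finset.mem_univ k)]
  exact ((hpd k).smul hk).add_posSemidef
    (posSemidef_sum _ fun j _ => (hpd j).posSemidef.smul (hP0 i j))

theorem det_gram_ne_zero (hθ : ∀ k, (θ k).1.rank = n) (hP : P ∈ rowStochastic ℝ (Fin K))
    (i : Fin K) : (gram θ P i).det ≠ 0 :=
  (posDef_gram hθ hP i).det_pos.ne'

theorem gram_mulVec_sub_halfGradient (x : EuclideanSpace ℝ (Fin n)) :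
    gram θ P i *ᵥ ofLp x - halfGradient ystar θ P i x =
      ∑ j, P i j • ((θ j).1ᵀ *ᵥ ofLp (ystar - (θ j).2)) := by
  rw [gram, halfGradient, sum_mulVec, ← Finset.sum_sub_distrib]
  refine Finset.sum_congr rfl fun j _ => ?_
  rw [smul_mulVec, ← mulVec_mulVec, ← smul_sub, ← mulVec_sub]
  congr 2
  simp only [response, ofLp_sub, ofLp_add]
  abel

/-- One Newton step from any input reaches the optimum, the stage cost being quadratic. -/
theorem optimalInput_eq_sub (hdet : (gram θ P i).det ≠ 0) (x : EuclideanSpace ℝ (Fin n)) :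
    optimalInput ystar θ P i = x - toLp 2 ((gram θ P i)⁻¹ *ᵥ halfGradient ystar θ P i x) := by
  rw [optimalInput, ← gram_mulVec_sub_halfGradient x, ← gram, mulVec_sub, mulVec_mulVec,
    nonsing_inv_mul _ hdet.isUnit, one_mulVec, toLp_sub, toLp_ofLp]

theorem optimalInput_eq_iff (hdet : (gram θ P i).det ≠ 0) {x : EuclideanSpace ℝ (Fin n)} :
    optimalInput ystar θ P i = x ↔ halfGradient ystar θ P i x = 0 := by
  rw [optimalInput_eq_sub hdet x, sub_eq_self, toLp_eq_zero]
  exact ⟨fun h => eq_zero_of_mulVec_eq_zero (by simp [det_nonsing_inv, hdet]) h,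
    fun h => by rw [h, mulVec_zero]⟩

theorem continuous_gram (P : Matrix (Fin K) (Fin K) ℝ) (i : Fin K) :
    Continuous fun θ : Param K m n => gram θ P i := by
  unfold gram
  fun_prop

theorem continuousAt_optimalInput (hdet : (gram θ P i).det ≠ 0) :
    ContinuousAt (fun θ' => optimalInput ystar θ' P i) θ := by
  have hinv : ContinuousAt (fun θ' : Param K m n => (gram θ' P i)⁻¹) θ :=
    (continuousAt_inv_of_det_ne_zero hdet).comp (f := fun θ' : Param K m n => gram θ' P i)
      (continuous_gram P i).continuousAt
  have hrhs : Continuous fun θ' : Param K m n =>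
      ∑ j, P i j • ((θ' j).1ᵀ *ᵥ ofLp (ystar - (θ' j).2)) := by fun_prop
  have hmulVec : Continuous fun p : Matrix (Fin n) (Fin n) ℝ × (Fin n → ℝ) => p.1 *ᵥ p.2 := by
    fun_prop
  exact (PiLp.continuous_toLp 2 _).continuousAt.comp
    (hmulVec.continuousAt.comp (hinv.prodMk hrhs.continuousAt))

variable {σ : ℝ} {Θ : Set (Param K m n)} {Pi0 : Set (EuclideanSpace ℝ (Fin n))}
  {f : Fin K → Measure (EuclideanSpace ℝ (Fin m))}

theorem eventually_isAdmissible (hθ : θ ∈ interior Θ) (hrank : ∀ k, (θ k).1.rank = n)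
    (hP : P ∈ rowStochastic ℝ (Fin K)) (hf : ∀ k, IsNoiseLaw σ (f k))
    (hopt : ∀ i, optimalInput ystar θ P i ∈ interior Pi0) :
    ∀ᶠ θ' in 𝓝 θ, IsAdmissible ystar σ Θ Pi0 θ' P f := by
  have hopen : IsOpen {A : Matrix (Fin m) (Fin n) ℝ | A.rank = n} := by
    simpa only [Fintype.card_fin] using isOpen_setOf_rank_eq_card (ι := Fin m) (κ := Fin n)
  have hrank' : ∀ᶠ θ' in 𝓝 θ, ∀ k, (θ' k).1.rank = n := eventually_all.2 fun k => by
    have hcont : Continuous fun θ' : Param K m n => (θ' k).1 := by fun_prop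
    exact hcont.continuousAt.eventually (hopen.mem_nhds (hrank k))
  have hopt' : ∀ᶠ θ' in 𝓝 θ, ∀ i, optimalInput ystar θ' P i ∈ Pi0 := eventually_all.2 fun i =>
    (continuousAt_optimalInput (det_gram_ne_zero hrank hP i)).eventually
      (mem_interior_iff_mem_nhds.1 (hopt i))
  filter_upwards [mem_interior_iff_mem_nhds.1 hθ, hrank', hopt'] with θ' hmem hr ho
  exact ⟨hmem, hr, hP, hf, ho⟩

end OptimalInput

section Residual

variable {K m n : ℕ} {P : Matrix (Fin K) (Fin K) ℝ}

/-- The parameters in which the offset `b_k` is replaced by `b_k + v_k`. -/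
def shiftOffset (θ : Param K m n) (v : Fin K → EuclideanSpace ℝ (Fin m)) : Param K m n :=
  fun k => ((θ k).1, (θ k).2 + v k)

theorem shiftOffset_zero (θ : Param K m n) : shiftOffset θ (fun _ => 0) = θ :=
  funext fun _ => Prod.ext rfl (add_zero _)

theorem response_shiftOffset (θ : Param K m n) (v : Fin K → EuclideanSpace ℝ (Fin m)) (k : Fin K)
    (x : EuclideanSpace ℝ (Fin n)) :
    response (shiftOffset θ v k) x = response (θ k) x + v k :=
  (add_assoc _ _ _).symm

theorem optimalInput_shiftOffset (ystar : EuclideanSpace ℝ (Fin m)) (θ : Param K m n)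
    {v : Fin K → EuclideanSpace ℝ (Fin m)} {i : Fin K}
    (hv : ∑ j, P i j • ((θ j).1ᵀ *ᵥ ofLp (v j)) = 0) :
    optimalInput ystar (shiftOffset θ v) P i = optimalInput ystar θ P i := by
  have hsum : ∑ j, P i j • ((θ j).1ᵀ *ᵥ ofLp (ystar - ((θ j).2 + v j))) =
      ∑ j, P i j • ((θ j).1ᵀ *ᵥ ofLp (ystar - (θ j).2)) := by
    simp only [← sub_sub, ofLp_sub _ _ (v _), mulVec_sub, smul_sub, Finset.sum_sub_distrib, hv,
      sub_zero]
  simp only [optimalInput, shiftOffset, hsum]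

/-- The offsets can be moved without affecting the optimal inputs when `P` is singular: it suffices
that `A_kᵀ v_k = d_k z` with `P d = 0`. -/
theorem exists_response_ne (hn : 0 < n) (ystar : EuclideanSpace ℝ (Fin m)) {θ : Param K m n}
    {s : Set (Param K m n)} (hs : s ∈ 𝓝 θ) (hrank : ∀ k, (θ k).1.rank = n) {d : Fin K → ℝ}
    (hd : d ≠ 0) (hPd : P *ᵥ d = 0) (x : EuclideanSpace ℝ (Fin n)) :
    ∃ θ' ∈ s, (∀ k, (θ' k).1 = (θ k).1) ∧
      (∀ i, optimalInput ystar θ' P i = optimalInput ystar θ P i) ∧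
      ∃ k, response (θ' k) x ≠ ystar := by
  by_cases! hres : ∃ k, response (θ k) x ≠ ystar
  · exact ⟨θ, mem_of_mem_nhds hs, fun _ => rfl, fun _ => rfl, hres⟩
  let z : Fin n → ℝ := Pi.single ⟨0, hn⟩ 1
  have hz : z ≠ 0 := Pi.single_ne_zero_iff.2 one_ne_zero
  choose v hv using fun k =>
    exists_transpose_mulVec_eq (A := (θ k).1) (by simpa using hrank k) (d k • z)
  have hcont : Continuous fun ε : ℝ => shiftOffset θ fun k => ε • toLp 2 (v k) := by
    unfold shiftOffset
    fun_prop
  have hmem : ∀ᶠ ε : ℝ in 𝓝 0, shiftOffset θ (fun k => ε • toLp 2 (v k)) ∈ s :=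
    hcont.continuousAt.eventually_mem (by simpa only [zero_smul, shiftOffset_zero] using hs)
  obtain ⟨ε, hε, hε0 : ε ≠ 0⟩ :=
    ((hmem.filter_mono nhdsWithin_le_nhds).and (eventually_mem_nhdsWithin (s := {0}ᶜ))).exists
  obtain ⟨k, hk⟩ := Function.ne_iff.1 hd
  refine ⟨_, hε, fun _ => rfl, fun i => optimalInput_shiftOffset ystar θ ?_, k, ?_⟩
  · calc ∑ j, P i j • ((θ j).1ᵀ *ᵥ ofLp (ε • toLp 2 (v j))) = (ε * (P *ᵥ d) i) • z := by
          simp only [ofLp_smul, mulVec_smul, hv, smul_smul, ← Finset.sum_smul, mulVec,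
            dotProduct, Finset.mul_sum]
          congr! 2
          ring
      _ = 0 := by rw [hPd, Pi.zero_apply, mul_zero, zero_smul]
  · have hvk : v k ≠ 0 := fun h => smul_ne_zero hk hz (by rw [← hv k, h, mulVec_zero])
    rw [response_shiftOffset, hres, Ne, add_eq_left]
    exact smul_ne_zero hε0 ((toLp_eq_zero 2).not.2 hvk)

end Residual

section Tilt

variable {K m n : ℕ} {ystar r : EuclideanSpace ℝ (Fin m)} {θ : Param K m n}
  {P : Matrix (Fin K) (Fin K) ℝ} {k : Fin K} {x : EuclideanSpace ℝ (Fin n)}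

/-- The perturbation `A_k + δ r e_lᵀ`, `b_k - δ x_l r` of state `k`, which leaves the response to
the input `x` unchanged. -/
noncomputable def tilt (θ : Param K m n) (k : Fin K) (r : EuclideanSpace ℝ (Fin m)) (l : Fin n)
    (x : EuclideanSpace ℝ (Fin n)) (δ : ℝ) : Param K m n :=
  Function.update θ k
    ((θ k).1 + δ • vecMulVec (ofLp r) (Pi.single l 1), (θ k).2 - (δ * x l) • r)

theorem tilt_zero (θ : Param K m n) (k : Fin K) (r : EuclideanSpace ℝ (Fin m)) (l : Fin n)
    (x : EuclideanSpace ℝ (Fin n)) : tilt θ k r l x 0 = θ := by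
  simp [tilt]

@[fun_prop]
theorem continuous_tilt (θ : Param K m n) (k : Fin K) (r : EuclideanSpace ℝ (Fin m)) (l : Fin n)
    (x : EuclideanSpace ℝ (Fin n)) : Continuous (tilt θ k r l x) :=
  continuous_const.update k (by fun_prop)

theorem response_tilt (θ : Param K m n) (k : Fin K) (r : EuclideanSpace ℝ (Fin m)) (l : Fin n)
    (x : EuclideanSpace ℝ (Fin n)) (δ : ℝ) (j : Fin K) (z : EuclideanSpace ℝ (Fin n)) :
    response (tilt θ k r l x δ j) z =
      response (θ j) z + (if j = k then δ * (z l - x l) else 0) • r := by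
  by_cases h : j = k
  · subst h
    simp only [tilt, response, Function.update_self, add_mulVec, smul_mulVec, vecMulVec_mulVec,
      single_one_dotProduct, if_true, toLp_add, toLp_smul, toLp_ofLp, op_smul_eq_smul]
    module
  · simp [tilt, h]

theorem halfGradient_tilt (ystar : EuclideanSpace ℝ (Fin m)) (θ : Param K m n)
    (P : Matrix (Fin K) (Fin K) ℝ) (i k : Fin K) (r : EuclideanSpace ℝ (Fin m)) (l : Fin n)
    (x : EuclideanSpace ℝ (Fin n)) (δ : ℝ) :
    halfGradient ystar (tilt θ k r l x δ) P i x = halfGradient ystar θ P i x +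
      δ • Pi.single l (P i k * (ofLp r ⬝ᵥ ofLp (response (θ k) x - ystar))) := by
  rw [halfGradient, halfGradient, ← sub_eq_iff_eq_add', ← Finset.sum_sub_distrib,
    Finset.sum_eq_single k]
  · simp only [response_tilt, sub_self, mul_zero, ite_self, zero_smul, add_zero, ← smul_sub,
      ← sub_mulVec]
    simp only [tilt, Function.update_self, transpose_add, add_sub_cancel_left, transpose_smul,
      transpose_vecMulVec, smul_mulVec, vecMulVec_mulVec]
    ext l'
    by_cases hl : l' = l
    · subst hl; simp; ring
    · simp [hl]
  · intro j _ hj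
    simp [tilt, hj]
  · simp

theorem continuousAt_inv_gram_tilt {i : Fin K} (hdet : (gram θ P i).det ≠ 0) (k : Fin K)
    (r : EuclideanSpace ℝ (Fin m)) (l : Fin n) (x : EuclideanSpace ℝ (Fin n)) :
    ContinuousAt (fun δ => (gram (tilt θ k r l x δ) P i)⁻¹) 0 :=
  (continuousAt_inv_of_det_ne_zero (by rwa [tilt_zero])).comp
    (f := fun δ => gram (tilt θ k r l x δ) P i)
    ((continuous_gram P i).comp (continuous_tilt θ k r l x)).continuousAt

theorem sub_optimalInput_tilt {i : Fin K} (hdet : (gram θ P i).det ≠ 0)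
    (hx : optimalInput ystar θ P i = x) (k : Fin K) (r : EuclideanSpace ℝ (Fin m)) (l : Fin n)
    {δ : ℝ} (hdetδ : (gram (tilt θ k r l x δ) P i).det ≠ 0) :
    x - optimalInput ystar (tilt θ k r l x δ) P i =
      δ • toLp 2 ((gram (tilt θ k r l x δ) P i)⁻¹ *ᵥ
        Pi.single l (P i k * (ofLp r ⬝ᵥ ofLp (response (θ k) x - ystar)))) := by
  rw [optimalInput_eq_sub hdetδ x, sub_sub_cancel, halfGradient_tilt,
    (optimalInput_eq_iff hdet).1 hx, zero_add, mulVec_smul, toLp_smul]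

theorem eventually_le_enorm_sub_optimalInput_tilt (hrank : ∀ k, (θ k).1.rank = n)
    (hP : P ∈ rowStochastic ℝ (Fin K)) (hx : ∀ i, optimalInput ystar θ P i = x) (l : Fin n)
    (hk : ∀ i, P i k ≠ 0) (hr : ofLp r ⬝ᵥ ofLp (response (θ k) x - ystar) ≠ 0) :
    ∀ᶠ c : ℝ≥0 in 𝓝 0, ∀ᶠ δ : ℝ in 𝓝 0, ∀ i,
      c * ‖δ‖ₑ ^ 2 ≤ ‖x - optimalInput ystar (tilt θ k r l x δ) P i‖ₑ ^ 2 := by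
  simp only [eventually_all]
  intro i
  have hdet := det_gram_ne_zero hrank hP i
  let slope : ℝ → EuclideanSpace ℝ (Fin n) := fun δ => toLp 2 ((gram (tilt θ k r l x δ) P i)⁻¹ *ᵥ
    Pi.single l (P i k * (ofLp r ⬝ᵥ ofLp (response (θ k) x - ystar))))
  have hslope : ContinuousAt slope 0 :=
    (show Continuous fun A : Matrix (Fin n) (Fin n) ℝ => toLp 2 (A *ᵥ Pi.single l
        (P i k * (ofLp r ⬝ᵥ ofLp (response (θ k) x - ystar)))) by fun_prop).continuousAt.comp
      (continuousAt_inv_gram_tilt hdet k r l x)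
  have hslope0 : slope 0 ≠ 0 := by
    refine (toLp_eq_zero 2).not.2 fun h => ?_
    rw [tilt_zero] at h
    exact mul_ne_zero (hk i) hr (Pi.single_eq_zero_iff.1
      (eq_zero_of_mulVec_eq_zero (by simp [det_nonsing_inv, hdet]) h))
  have hpos : 0 < ‖slope 0‖ₑ ^ 2 := ENNReal.pow_pos (enorm_pos.2 hslope0) 2
  have hslope_sq : ContinuousAt (fun δ => ‖slope δ‖ₑ ^ 2) 0 :=
    (ENNReal.continuous_pow 2).continuousAt.comp hslope.enorm
  have hdetδ : ∀ᶠ δ in 𝓝 0, (gram (tilt θ k r l x δ) P i).det ≠ 0 := by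
    refine ((continuous_gram P i).matrix_det.comp
      (continuous_tilt θ k r l x)).continuousAt.eventually_ne ?_
    simpa [tilt_zero] using hdet
  filter_upwards [(ENNReal.continuous_coe.tendsto 0).eventually_lt_const hpos] with c hc
  filter_upwards [hdetδ, hslope_sq.eventually_const_lt hc] with δ hδ hcδ
  rw [sub_optimalInput_tilt hdet (hx i) k r l hδ, enorm_smul, mul_pow, mul_comm (c : ℝ≥0∞)]
  gcongr

end Tilt

section WorstCase

variable {K m n T : ℕ} {U : Type*} [MeasurableSpace U] {ystar : EuclideanSpace ℝ (Fin m)} {σ : ℝ}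
  {Θ : Set (Param K m n)} {Pi0 : Set (EuclideanSpace ℝ (Fin n))} {ρ : Measure U} {π : Fin K → ℝ}
  {θ θ' : Param K m n} {P : Matrix (Fin K) (Fin K) ℝ}

theorem cumulativeMSE_le_worstEstimationMSE {f : Fin K → Measure (EuclideanSpace ℝ (Fin m))}
    (h : IsAdmissible ystar σ Θ Pi0 θ P f) (ρ : Measure U) (π : Fin K → ℝ)
    (μ est : CausalRule K m n U) :
    cumulativeMSE T ystar ρ π μ est θ P f ≤ worstEstimationMSE T ystar σ Θ Pi0 ρ π μ est :=
  le_iSup_of_le θ (le_iSup_of_le P (le_iSup_of_le f (le_iSup_of_le h le_rfl)))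

theorem worstEstimationMSE_self (ρ : Measure U) (π : Fin K → ℝ) (μ : CausalRule K m n U) :
    worstEstimationMSE T ystar σ Θ Pi0 ρ π μ μ = worstInputMSE T ystar σ Θ Pi0 ρ π μ :=
  rfl

variable [IsProbabilityMeasure ρ] {d : ℝ≥0∞} {r : EuclideanSpace ℝ (Fin m)}

theorem le_four_mul_worstEstimationMSE (hT : 0 < T) (hπ : π ∈ stdSimplex ℝ (Fin K))
    (μ est : CausalRule K m n U)
    (hθ : IsAdmissible ystar σ Θ Pi0 θ P fun _ => lineGaussian r)
    (hθ' : IsAdmissible ystar σ Θ Pi0 θ' P fun _ => lineGaussian r)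
    (hsep : ∀ i, d ≤ ‖optimalInput ystar θ P i - optimalInput ystar θ' P i‖ₑ ^ 2) :
    d ≤ 4 * worstEstimationMSE T ystar σ Θ Pi0 ρ π μ est :=
  calc d ≤ 2 * (worstEstimationMSE T ystar σ Θ Pi0 ρ π μ est +
        worstEstimationMSE T ystar σ Θ Pi0 ρ π μ est) := by
        refine (le_two_mul_cumulativeMSE_add (ρ := ρ) hT hπ hθ.stochastic μ est hsep r).trans ?_
        gcongr <;> exact cumulativeMSE_le_worstEstimationMSE ‹_› ρ π μ est
    _ = 4 * worstEstimationMSE T ystar σ Θ Pi0 ρ π μ est := by ring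

theorem mul_le_eight_mul_worstEstimationMSE_add (hπ : π ∈ stdSimplex ℝ (Fin K))
    (μ est : CausalRule K m n U) {x : EuclideanSpace ℝ (Fin n)}
    (hx : ∀ i, optimalInput ystar θ P i = x) {k : Fin K} {l : Fin n} {δ : ℝ}
    (hθ : IsAdmissible ystar σ Θ Pi0 θ P fun _ => lineGaussian r)
    (hθ' : IsAdmissible ystar σ Θ Pi0 (tilt θ k r l x δ) P fun _ => lineGaussian r)
    (hsep : ∀ i, d ≤ ‖x - optimalInput ystar (tilt θ k r l x δ) P i‖ₑ ^ 2) :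
    T * d ≤ 8 * worstEstimationMSE T ystar σ Θ Pi0 ρ π μ est +
      T * d * (2 * (‖δ‖ₑ ^ 2 * worstInputMSE T ystar σ Θ Pi0 ρ π μ)) := by
  have henergy (i j : Fin K) (z : EuclideanSpace ℝ (Fin n)) :
      ‖if j = k then δ * (z l - x l) else 0‖ₑ ^ 2 ≤
        ‖δ‖ₑ ^ 2 * ‖z - optimalInput ystar θ P i‖ₑ ^ 2 := by
    split_ifs
    · rw [enorm_mul, mul_pow, hx]
      gcongr
      exact enorm_le_iff_norm_le.2 (PiLp.norm_apply_le (z - x) l)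
    · simp
  refine (mul_le_four_mul_cumulativeMSE_add (ρ := ρ) hπ hθ.stochastic μ est
    (by simpa only [hx] using hsep) (fun j => by split_ifs <;> fun_prop)
    (response_tilt θ k r l x δ) henergy).trans ?_
  calc _ ≤ 4 * (worstEstimationMSE T ystar σ Θ Pi0 ρ π μ est +
          worstEstimationMSE T ystar σ Θ Pi0 ρ π μ est) +
        T * d * (2 * (‖δ‖ₑ ^ 2 * worstInputMSE T ystar σ Θ Pi0 ρ π μ)) := by
        rw [← worstEstimationMSE_self]
        gcongr <;> exact cumulativeMSE_le_worstEstimationMSE ‹_› ρ π μ _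
    _ = _ := by ring

end WorstCase

section Optimization

/-- The choice `e = κ / I` keeps the last term of the hypothesis below half of its left-hand
side. -/
theorem exists_mul_le_mul_of_forall_le {c e₀ : ℝ≥0} (hc : 0 < c) (he₀ : 0 < e₀) :
    ∃ C : ℝ≥0, 0 < C ∧ ∀ (T : ℕ) (E I : ℝ≥0∞), c * e₀ ≤ 4 * E → c * e₀ ≤ 4 * I →
      (∀ e : ℝ≥0, e ≤ e₀ → T * (c * e) ≤ 8 * E + T * (c * e) * (2 * (e * I))) →
        C * T ≤ E * I := by
  let κ := min (c * e₀ / 4 * e₀) (1 / 4)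
  have hκ : 0 < κ := by positivity
  refine ⟨c * κ / 16, by positivity, fun T E I hE hI h => ?_⟩
  have hpos : (0 : ℝ≥0∞) < c * e₀ := by positivity
  have hE0 : E ≠ 0 := by rintro rfl; exact hpos.not_ge (by simpa using hE)
  have hI0 : I ≠ 0 := by rintro rfl; exact hpos.not_ge (by simpa using hI)
  rcases eq_or_ne I ∞ with rfl | hI'
  · simp [ENNReal.mul_top hE0]
  rcases eq_or_ne E ∞ with rfl | hE'
  · simp [ENNReal.top_mul hI0]
  lift E to ℝ≥0 using hE'
  lift I to ℝ≥0 using hI'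
  norm_cast at hI h hI0 ⊢
  have he : κ / I ≤ e₀ := by
    rw [div_le_iff₀' (pos_of_ne_zero hI0)]
    refine (min_le_left _ _).trans ?_
    gcongr
    exact (div_le_iff₀' four_pos).2 hI
  have hhalf : T * (c * (κ / I)) / 2 ≤ 8 * E := by
    refine le_of_add_le_add_right (a := T * (c * (κ / I)) / 2) ?_
    calc T * (c * (κ / I)) / 2 + T * (c * (κ / I)) / 2 = T * (c * (κ / I)) := add_halves _
      _ ≤ 8 * E + T * (c * (κ / I)) * (2 * κ) := by
        simpa only [div_mul_cancel₀ _ hI0] using h _ he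
      _ ≤ 8 * E + T * (c * (κ / I)) * (2 * (1 / 4)) := by gcongr; exact min_le_right _ _
      _ = 8 * E + T * (c * (κ / I)) / 2 := by ring
  calc c * κ / 16 * T = T * (c * (κ / I)) / 2 / 8 * I := by field_simp; ring
    _ ≤ E * I := by gcongr; exact (div_le_iff₀' (by norm_num)).2 hhalf

end Optimization

section Uniform

variable {K : ℕ}

theorem uniform_mem_rowStochastic (hK : K ≠ 0) :
    (Matrix.of fun _ _ => (K : ℝ)⁻¹) ∈ rowStochastic ℝ (Fin K) :=
  mem_rowStochastic_iff_sum.2 ⟨fun _ _ => by simp, fun _ => by simp [hK]⟩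

theorem exists_uniform_mulVec_eq_zero (hK : 1 < K) (a : ℝ) :
    ∃ d : Fin K → ℝ, d ≠ 0 ∧ (Matrix.of fun _ _ => a : Matrix (Fin K) (Fin K) ℝ) *ᵥ d = 0 := by
  have : Nontrivial (Fin K) := Fin.nontrivial_iff_two_le.2 hK
  obtain ⟨j, k, hjk⟩ := exists_pair_ne (Fin K)
  refine ⟨Pi.single j 1 - Pi.single k 1, sub_ne_zero.2 ?_, ?_⟩
  · exact fun h => hjk (by simpa [Pi.single_apply] using congrFun h j)
  · ext i
    simp [mulVec_sub]

end Uniform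

section HardInstances

variable {K m n : ℕ} {ystar : EuclideanSpace ℝ (Fin m)} {σ : ℝ} {Θ : Set (Param K m n)}
  {Pi0 : Set (EuclideanSpace ℝ (Fin n))} {θ : Param K m n} {P : Matrix (Fin K) (Fin K) ℝ}
  {x : EuclideanSpace ℝ (Fin n)}

theorem enorm_sqrt_sq (e : ℝ≥0) : ‖√(e : ℝ)‖ₑ ^ 2 = e := by
  rw [← enorm_pow, Real.sq_sqrt e.coe_nonneg, Real.enorm_of_nonneg e.coe_nonneg,
    ENNReal.ofReal_coe_nnreal]

theorem exists_tilt_of_response_ne (hn : 0 < n) (hσ : 0 < σ) (hP : P ∈ rowStochastic ℝ (Fin K))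
    {k : Fin K} (hk : ∀ i, P i k ≠ 0) (hrank : ∀ j, (θ j).1.rank = n) (hθ : θ ∈ interior Θ)
    (hx : ∀ i, optimalInput ystar θ P i = x) (hxPi : x ∈ interior Pi0)
    (hres : response (θ k) x ≠ ystar) :
    ∃ (r : EuclideanSpace ℝ (Fin m)) (l : Fin n) (c e₀ : ℝ≥0), 0 < c ∧ 0 < e₀ ∧ ∀ e ≤ e₀,
      IsAdmissible ystar σ Θ Pi0 (tilt θ k r l x √e) P (fun _ => lineGaussian r) ∧
      ∀ i, c * e ≤ ‖x - optimalInput ystar (tilt θ k r l x √e) P i‖ₑ ^ 2 := by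
  let q := response (θ k) x - ystar
  have hscale : Tendsto (fun ε : ℝ => ε • q) (𝓝[>] 0) (𝓝 0) :=
    tendsto_nhdsWithin_of_tendsto_nhds (Continuous.tendsto' (by fun_prop) _ _ (zero_smul ℝ q))
  obtain ⟨ε, hnoise, hε : 0 < ε⟩ :=
    ((hscale.eventually (eventually_isNoiseLaw_lineGaussian hσ)).and self_mem_nhdsWithin).exists
  have hr : ofLp (ε • q) ⬝ᵥ ofLp q ≠ 0 := by
    rw [ofLp_smul, smul_dotProduct]
    exact smul_ne_zero hε.ne' (dotProduct_self_eq_zero.not.2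
      ((ofLp_eq_zero 2).not.2 (sub_ne_zero.2 hres)))
  obtain ⟨c, hsep, hc : 0 < c⟩ := (((eventually_le_enorm_sub_optimalInput_tilt hrank hP hx ⟨0, hn⟩
    hk hr).filter_mono nhdsWithin_le_nhds).and (self_mem_nhdsWithin (s := Set.Ioi 0))).exists
  have hadm : ∀ᶠ δ in 𝓝 0, IsAdmissible ystar σ Θ Pi0 (tilt θ k (ε • q) ⟨0, hn⟩ x δ) P
      fun _ => lineGaussian (ε • q) :=
    (Continuous.tendsto' (by fun_prop) _ _ (tilt_zero θ k _ _ x)).eventually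
      (eventually_isAdmissible hθ hrank hP (fun _ => hnoise) fun i => by rwa [hx i])
  have hsqrt : Tendsto (fun e : ℝ≥0 => √(e : ℝ)) (𝓝 0) (𝓝 0) :=
    Continuous.tendsto' (by fun_prop) _ _ (by simp)
  obtain ⟨e₀, he₀, h⟩ := (nhds_bot_basis_Iic.eventually_iff (p := fun e : ℝ≥0 => _)).1
    (hsqrt.eventually (hadm.and hsep))
  refine ⟨ε • q, ⟨0, hn⟩, c, e₀, hc, he₀, fun e he => ⟨(h he).1, fun i => ?_⟩⟩
  simpa only [enorm_sqrt_sq] using (h he).2 i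

theorem exists_mul_le_worstEstimationMSE_mul_worstInputMSE (hn : 0 < n) (hσ : 0 < σ)
    (hP : P ∈ rowStochastic ℝ (Fin K)) {k : Fin K} (hk : ∀ i, P i k ≠ 0)
    (hrank : ∀ j, (θ j).1.rank = n) (hθ : θ ∈ interior Θ)
    (hx : ∀ i, optimalInput ystar θ P i = x) (hxPi : x ∈ interior Pi0)
    (hres : response (θ k) x ≠ ystar) :
    ∃ C : ℝ≥0, 0 < C ∧ ∀ π ∈ stdSimplex ℝ (Fin K),
      ∀ (U : Type*) [MeasurableSpace U] (ρ : Measure U) [IsProbabilityMeasure ρ]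
        (μ est : CausalRule K m n U) (T : ℕ),
        C * T ≤ worstEstimationMSE T ystar σ Θ Pi0 ρ π μ est *
          worstInputMSE T ystar σ Θ Pi0 ρ π μ := by
  obtain ⟨r, l, c, e₀, hc, he₀, htilt⟩ :=
    exists_tilt_of_response_ne hn hσ hP hk hrank hθ hx hxPi hres
  obtain ⟨C, hC, hprod⟩ := exists_mul_le_mul_of_forall_le hc he₀
  refine ⟨C, hC, fun π hπ U _ ρ _ μ est T => ?_⟩
  rcases T.eq_zero_or_pos with rfl | hT
  · simp
  have hadm := (htilt 0 zero_le).1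
  rw [NNReal.coe_zero, Real.sqrt_zero, tilt_zero] at hadm
  obtain ⟨hadm₀, hsep₀⟩ := htilt e₀ le_rfl
  have hfirst (est : CausalRule K m n U) := le_four_mul_worstEstimationMSE (ρ := ρ) hT hπ μ est
    hadm hadm₀ (by simpa only [hx] using hsep₀)
  refine hprod T _ _ (hfirst est) (hfirst μ) fun e he => ?_
  simpa only [enorm_sqrt_sq] using
    mul_le_eight_mul_worstEstimationMSE_add hπ μ est hx hadm (htilt e he).1 (htilt e he).2

end HardInstances

end JumpAffine

theorem mainTheorem3_general {K m n : ℕ} (hK : 1 < K) (hn : 0 < n)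
    (ystar : EuclideanSpace ℝ (Fin m)) (σ : ℝ) (hσ : 0 < σ)
    (Pi0 : Set (EuclideanSpace ℝ (Fin n))) (Θ : Set (JumpAffine.Param K m n))
    (hint : ∃ θ ∈ interior Θ, (∀ k, (θ k).1.rank = n) ∧
      ∀ i, JumpAffine.optimalInput ystar θ (Matrix.of fun _ _ => (K : ℝ)⁻¹) i ∈ interior Pi0) :
    ∃ C : ℝ, 0 < C ∧
      ∀ (π : Fin K → ℝ), π ∈ stdSimplex ℝ (Fin K) →
      ∀ (U : Type*) [MeasurableSpace U] (ρ : Measure U) [IsProbabilityMeasure ρ]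
        (μ est : JumpAffine.CausalRule K m n U) (T : ℕ),
        ENNReal.ofReal (C * T) ≤
          JumpAffine.worstEstimationMSE T ystar σ Θ Pi0 ρ π μ est *
            JumpAffine.worstInputMSE T ystar σ Θ Pi0 ρ π μ := by
  open JumpAffine in
  obtain ⟨θ₀, hθ₀, hrank₀, hopt₀⟩ := hint
  have hP := uniform_mem_rowStochastic (K := K) (by lia)
  obtain ⟨d, hd, hPd⟩ := exists_uniform_mulVec_eq_zero hK (K : ℝ)⁻¹
  let i₀ : Fin K := ⟨0, by lia⟩
  obtain ⟨θ, hθ, hA, hopt, k, hres⟩ := exists_response_ne hn ystar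
    (isOpen_interior.mem_nhds hθ₀) hrank₀ hd hPd (optimalInput ystar θ₀ _ i₀)
  obtain ⟨C, hC, hprod⟩ := exists_mul_le_worstEstimationMSE_mul_worstInputMSE hn hσ hP
    (fun i => by simpa using by lia) (fun j => by rw [hA, hrank₀]) hθ
    (fun i => (hopt i).trans rfl) (hopt₀ i₀) hres
  refine ⟨C, hC, fun π hπ U _ ρ _ μ est T => ?_⟩
  rw [ENNReal.ofReal_mul C.coe_nonneg, ENNReal.ofReal_coe_nnreal, ENNReal.ofReal_natCast]
  exact hprod π hπ U ρ μ est T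

theorem mainTheorem3 {K m n : ℕ} (hK : 1 < K) (hn : 0 < n)
    (ystar : EuclideanSpace ℝ (Fin m)) (σ : ℝ) (hσ : 0 < σ)
    (Pi0 : Set (EuclideanSpace ℝ (Fin n))) (hPi_convex : Convex ℝ Pi0) (hPi_compact : IsCompact Pi0)
    (Θ : Set (JumpAffine.Param K m n)) (hΘ : IsCompact Θ)
    (hint : ∃ θ ∈ interior Θ, (∀ k, (θ k).1.rank = n) ∧
      ∀ i, JumpAffine.optimalInput ystar θ (Matrix.of fun _ _ => (K : ℝ)⁻¹) i ∈ interior Pi0) :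
    ∃ C : ℝ, 0 < C ∧
      ∀ (π : Fin K → ℝ), π ∈ stdSimplex ℝ (Fin K) →
      ∀ (U : Type*) [MeasurableSpace U] (ρ : Measure U) [IsProbabilityMeasure ρ]
        (μ est : JumpAffine.CausalRule K m n U) (T : ℕ),
        ENNReal.ofReal (C * T) ≤
          JumpAffine.worstEstimationMSE T ystar σ Θ Pi0 ρ π μ est *
            JumpAffine.worstInputMSE T ystar σ Θ Pi0 ρ π μ :=
  mainTheorem3_general hK hn ystar σ hσ Pi0 Θ hint
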